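/- Let $m\ge 0$, $p>q\ge 0$ be integers. Write $\wedge^p$ for the space of smooth skewsymmetric contravariant tensor fields of degree $p$ on $\mathbb R^m$, $\mathcal D^k=\mathcal D^k(\wedge^p,\wedge^q)$ for the differential operators of order at most $k$ from $\wedge^p$ to $\wedge^q$, and $\mathcal S^1=C^\infty(\mathbb R^m,\mathbb R^m\otimes \mathrm{Hom}(\wedge^p\mathbb R^m,\wedge^q\mathbb R^m))$ for the space of principal symbols of order $1$, all with the action of vector fields by Lie derivative. Let $sl_{m+1}$ be the Lie algebra of the vector fields $-h^i\partial_i-A^i_jx^j\partial_i+\alpha(x)x^i\partial_i$ on $\mathbb R^m$ ($h\in\mathbb R^m$, $A\in \mathfrak{gl}(m,\mathbb R)$, $\alpha\in\mathbb R^{m*}$), and let $$\theta: H^n(sl_{m+1},\mathcal S^1)\to H^{n+1}(sl_{m+1},\mathcal D^0)$$ be the connecting homomorphism of the exact sequence $0\to\mathcal D^0\to\mathcal D^1\xrightarrow{\sigma}\mathcal S^1\to 0$, for the Chevalley–Eilenberg differential $$(\partial c)(X_0,\dots,X_n)=\sum_i(-1)^iL_{X_i}c(\dots,\hat X_i,\dots)+\sum_{i<j}(-1)^{i+j}c([X_i,X_j],\dots,\hat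 X_i,\dots,\hat X_j,\dots).$$ For $\gamma\in\wedge^t\mathfrak{gl}(m,\mathbb R)^*$ and an alternating $u$-linear map $I$ on $\mathbb R^{m*}$ with values in a representation $V$ of $\mathfrak{gl}(m,\mathbb R)$, let $\chi(\gamma\otimes I)$ be the $(t+u)$-cochain on $sl_{m+1}$ with values in $C^\infty(\mathbb R^m,V)$ $$\chi(\gamma\otimes I)(X_0,\dots,X_{t+u-1})=\frac{(-1)^t}{t!\,u!\,(m+1)^u}\sum_\nu \mathrm{sign}(\nu)\,\gamma(DX_{\nu_0},\dots,DX_{\nu_{t-1}})\,I(d\,\mathrm{tr}DX_{\nu_t},\dots,d\,\mathrm{tr}DX_{\nu_{t+u-1}}),$$ where $\nu$ runs over the permutations of $\{0,\dots,t+u-1\}$. Put $$I_0(\alpha_1,\dots,\alpha_{p-q})(T)=i_{\alpha_1}\cdots i_{\alpha_{p-q}}T,\qquad I_1(\alpha_1,\dots,\alpha_{p-q-1})(\eta)(T)=i_\eta i_{\alpha_1}\cdots i_{\alpha_{p-q-1}}T$$ for $T\in\wedge^p\mathbb R^m$ and $\eta,\alpha_j\in\mathbb R^{m*}$, where $(i_\alpha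 T)(\beta_1,\beta_2,\dots)=T(\alpha,\beta_1,\beta_2,\dots)$. Then, for every $a\ge 0$ and every $\gamma\in(\wedge^a\mathfrak{gl}(m,\mathbb R)^*)_{\mathfrak{gl}\text{-inv}}$, the cochains $\chi(\gamma\otimes I_1)$ (with values in $\mathcal S^1$) and $\chi(\gamma\otimes I_0)$ (with values in $C^\infty(\mathbb R^m,\mathrm{Hom}(\wedge^p\mathbb R^m,\wedge^q\mathbb R^m))=\mathcal D^0$) are cocycles and $$\theta\big([\chi(\gamma\otimes I_1)]\big)=(-1)^{a}\,(p-q)\,(m+1)\,[\chi(\gamma\otimes I_0)].$$ In other words, when invariant forms $\gamma$ are identified with classes in the source of $\theta$ by $\gamma\mapsto[\chi(\gamma\otimes I_1)]$ and with classes in its target by $\gamma\mapsto[\chi(\gamma\otimes I_0)]$, one has $\theta(\gamma)=(-1)^{|\gamma|}(p-q)(m+1)\gamma$. -/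

import Mathlib

open scoped ContDiff

set_option maxSynthPendingDepth 3
set_option linter.unusedSectionVars false
set_option linter.unusedSimpArgs false

noncomputable section

section Alternating

variable {R L N : Type*} [CommRing R] [AddCommGroup L] [Module R L] [AddCommGroup N] [Module R N]

/-- The derivation of the space of alternating maps induced by `D`:
`c ↦ ((x₁, …, xₙ) ↦ ∑ j, c (x₁, …, D xⱼ, …, xₙ))`. -/
def altDer (D : L →ₗ[R] L) {n : ℕ} (c : L [⋀^Fin n]→ₗ[R] N) : L [⋀^Fin n]→ₗ[R] N where
  toFun x := ∑ j, c (Function.update x j (D (x j)))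
  map_update_add' := by
    intro inst x i a b
    obtain rfl : inst = instDecidableEqFin n := Subsingleton.elim _ _
    rw [← Finset.sum_add_distrib]
    refine Finset.sum_congr rfl fun j _ => ?_
    rcases eq_or_ne j i with rfl | h
    · simp only [Function.update_self, Function.update_idem, map_add, map_smul,
        AlternatingMap.map_update_add, AlternatingMap.map_update_smul]
    · simp [Function.update_of_ne h, Function.update_comm h.symm]
  map_update_smul' := by
    intro inst x i r a
    obtain rfl : inst = instDecidableEqFin n := Subsingleton.elim _ _
    rw [Finset.smul_sum]
    refine Finset.sum_congr rfl fun j _ => ?_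
    rcases eq_or_ne j i with rfl | h
    · simp only [Function.update_self, Function.update_idem, map_add, map_smul,
        AlternatingMap.map_update_add, AlternatingMap.map_update_smul]
    · simp [Function.update_of_ne h, Function.update_comm h.symm]
  map_eq_zero_of_eq' := by
    intro x i j hx hij
    rw [← Finset.add_sum_erase _ _ (Finset.mem_univ i),
      ← Finset.add_sum_erase _ _ (Finset.mem_erase.2 ⟨hij.symm, Finset.mem_univ j⟩),
      Finset.sum_eq_zero, add_zero]
    · have h : Function.update x j (D (x j))
          = (Function.update x i (D (x i))) ∘ Equiv.swap i j := by
        ext k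
        rcases eq_or_ne k i with rfl | hki
        · simp [hij, Function.update_of_ne hij.symm, hx]
        rcases eq_or_ne k j with rfl | hkj
        · simp [hx]
        · simp [Equiv.swap_apply_of_ne_of_ne hki hkj, hki, hkj]
      rw [h, AlternatingMap.map_swap _ _ hij, add_neg_cancel]
    · intro k hk
      simp only [Finset.mem_erase, Finset.mem_univ, and_true, ne_eq] at hk
      refine c.map_eq_zero_of_eq _ ?_ hij
      rw [Function.update_of_ne (Ne.symm hk.2), Function.update_of_ne (Ne.symm hk.1), hx]

theorem altDer_apply (D : L →ₗ[R] L) {n : ℕ} (c : L [⋀^Fin n]→ₗ[R] N) (x : Fin n → L) :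
    altDer D c x = ∑ j, c (Function.update x j (D (x j))) := rfl

/-- Uncurrying in the first variable. -/
theorem exists_alt_uncurry {n : ℕ} (F : L →ₗ[R] L [⋀^Fin n]→ₗ[R] N)
    (hF : ∀ (x : L) (v : Fin n → L) (j : Fin n), v j = x → F x v = 0) :
    ∃ a : L [⋀^Fin (n + 1)]→ₗ[R] N, ∀ v, a v = F (v 0) (Fin.tail v) := by
  refine ⟨{ (LinearMap.uncurryLeft (M := fun _ : Fin (n + 1) => L)
      (AlternatingMap.toMultilinearMapLM.comp F)) with
    map_eq_zero_of_eq' := ?_ }, fun v => rfl⟩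
  intro v i j hv hij
  change F (v 0) (Fin.tail v) = 0
  induction i using Fin.cases with
  | zero =>
    induction j using Fin.cases with
    | zero => exact absurd rfl hij
    | succ j => exact hF _ _ j hv.symm
  | succ i =>
    induction j using Fin.cases with
    | zero => exact hF _ _ i hv
    | succ j => exact (F (v 0)).map_eq_zero_of_eq _ hv (fun h => hij (by rw [h]))

end Alternating

/-! ### The Chevalley–Eilenberg complex -/

namespace CE

variable {K L M : Type*} [Field K] [LieRing L] [LieAlgebra K L]
  [AddCommGroup M] [Module K M] [LieRingModule L M] [LieModule K L M]

/-- The Lie derivative of cochains,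
`(L_z c)(x₁, …, x_n) = ⁅z, c(x₁, …, x_n)⁆ - ∑ j, c(x₁, …, ⁅z, xⱼ⁆, …, x_n)`. -/
def lieCochain {n : ℕ} (z : L) (c : L [⋀^Fin n]→ₗ[K] M) : L [⋀^Fin n]→ₗ[K] M :=
  (LieModule.toEnd K L M z).compAlternatingMap c - altDer (LieAlgebra.ad K L z) c

theorem lieCochain_apply {n : ℕ} (z : L) (c : L [⋀^Fin n]→ₗ[K] M) (x : Fin n → L) :
    lieCochain z c x = ⁅z, c x⁆ - ∑ j, c (Function.update x j ⁅z, x j⁆) := rfl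

/-- The Chevalley–Eilenberg coboundary, as a function:
`(∂c)(x₀, …, x_n) = ∑ i, (-1)^i ⁅xᵢ, c(x₀, …, x̂ᵢ, …, x_n)⁆
  + ∑ i < j, (-1)^(i+j) c(⁅xᵢ, xⱼ⁆, x₀, …, x̂ᵢ, …, x̂ⱼ, …, x_n)`.
In the second sum the bracket is kept in the place of `xⱼ` instead of being moved to the first
place; as it moves over `j - 1` arguments, the sign `(-1)^(i+j)` becomes `-(-1)^i`. -/
def dFun {n : ℕ} (c : L [⋀^Fin n]→ₗ[K] M) (x : Fin (n + 1) → L) : M :=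
  ∑ i : Fin (n + 1), (-1 : K) ^ (i : ℕ) •
    (⁅x i, c (i.removeNth x)⁆
      - ∑ j ∈ Finset.Ioi i, c (i.removeNth (Function.update x j ⁅x i, x j⁆)))

theorem dFun_zero (c : L [⋀^Fin 0]→ₗ[K] M) (x : Fin 1 → L) :
    dFun c x = ⁅x 0, c ![]⁆ := by
  have : (Finset.Ioi (0 : Fin 1)) = ∅ := by decide
  simp [dFun, this]
  congr 2
  exact Subsingleton.elim _ _

theorem dFun_succ {n : ℕ} (c : L [⋀^Fin (n + 1)]→ₗ[K] M) (x : Fin (n + 2) → L) :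
    dFun c x = lieCochain (x 0) c (Fin.tail x) - dFun (c.curryLeft (x 0)) (Fin.tail x) := by
  rw [dFun, Fin.sum_univ_succ, sub_eq_add_neg (lieCochain _ _ _), lieCochain_apply, dFun,
    ← Finset.sum_neg_distrib]
  congr 1
  · simp only [Fin.val_zero, pow_zero, one_smul]
    congr 1
    have : Finset.Ioi (0 : Fin (n + 2)) = Finset.univ.map (Fin.succEmb (n + 1)) := by
      ext k; simp [Fin.pos_iff_ne_zero, Fin.exists_succ_eq]
    rw [this, Finset.sum_map]
    refine Finset.sum_congr rfl fun j _ => ?_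
    congr 1
    simp only [Fin.removeNth_zero]
    simp [Fin.tail_update_succ, Fin.tail]
  · refine Finset.sum_congr rfl fun i _ => ?_
    have hI : Finset.Ioi i.succ = (Finset.Ioi i).map (Fin.succEmb (n + 1)) := by
      ext k
      induction k using Fin.cases with
      | zero => simp
      | succ k => simp
    have hr : ∀ y : Fin (n + 2) → L, i.succ.removeNth y
        = Matrix.vecCons (y 0) (i.removeNth (Fin.tail y)) := by
      intro y
      ext k
      induction k using Fin.cases with
      | zero => simp [Fin.removeNth]
      | succ k => simp [Fin.removeNth, Fin.tail]
    rw [hI, Finset.sum_map, Fin.val_succ, pow_succ, mul_neg_one, neg_smul]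
    congr 3
    · simp [hr, Fin.tail]
    · refine Finset.sum_congr rfl fun j _ => ?_
      simp only [Fin.coe_succEmb, hr, Fin.tail_update_succ]
      rw [Function.update_of_ne (Fin.succ_ne_zero j).symm]
      rfl

theorem dFun_add {n : ℕ} (c c' : L [⋀^Fin n]→ₗ[K] M) (x : Fin (n + 1) → L) :
    dFun (c + c') x = dFun c x + dFun c' x := by
  simp only [dFun, AlternatingMap.add_apply, lie_add, Finset.sum_add_distrib,
    ← Finset.sum_add_distrib, ← smul_add]
  refine Finset.sum_congr rfl fun i _ => ?_
  rw [Finset.sum_add_distrib]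
  congr 1
  abel

theorem dFun_smul {n : ℕ} (r : K) (c : L [⋀^Fin n]→ₗ[K] M) (x : Fin (n + 1) → L) :
    dFun (r • c) x = r • dFun c x := by
  simp only [dFun, AlternatingMap.smul_apply, lie_smul, Finset.smul_sum]
  refine Finset.sum_congr rfl fun i _ => ?_
  rw [← Finset.smul_sum, ← smul_sub, smul_comm]

theorem lieCochain_curryLeft {n : ℕ} (z y : L) (c : L [⋀^Fin (n + 1)]→ₗ[K] M) :
    (lieCochain z c).curryLeft y = lieCochain z (c.curryLeft y) - c.curryLeft ⁅z, y⁆ := by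
  ext x
  simp only [AlternatingMap.curryLeft_apply_apply, lieCochain_apply, AlternatingMap.sub_apply]
  rw [Fin.sum_univ_succ]
  simp only [Matrix.cons_val_zero, Matrix.cons_val_succ]
  have h0 : Function.update (Matrix.vecCons y x) 0 ⁅z, y⁆ = Matrix.vecCons ⁅z, y⁆ x :=
    Fin.update_cons_zero _ _ _
  have h1 : ∀ j, Function.update (Matrix.vecCons y x) (Fin.succ j) ⁅z, x j⁆
      = Matrix.vecCons y (Function.update x j ⁅z, x j⁆) := fun j =>
    (Fin.cons_update _ _ _ _).symm
  rw [h0]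
  simp only [h1]
  abel

theorem exists_d {n : ℕ} (c : L [⋀^Fin n]→ₗ[K] M) :
    ∃ a : L [⋀^Fin (n + 1)]→ₗ[K] M, ∀ x, a x = dFun c x := by
  induction n with
  | zero =>
    refine ⟨AlternatingMap.ofSubsingleton K L M (0 : Fin 1)
      { toFun := fun y => ⁅y, c ![]⁆
        map_add' := fun y z => add_lie y z _
        map_smul' := fun r y => smul_lie r y _ }, fun x => ?_⟩
    rw [dFun_zero]
    rfl
  | succ n ih =>
    choose a ha using ih
    let F : L →ₗ[K] L [⋀^Fin (n + 1)]→ₗ[K] M :=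
      { toFun := fun y => lieCochain y c - a (c.curryLeft y)
        map_add' := by
          intro y z
          ext x
          simp only [AlternatingMap.sub_apply, AlternatingMap.add_apply, ha, map_add, dFun_add,
            lieCochain_apply, add_lie, AlternatingMap.map_update_add, Finset.sum_add_distrib]
          abel
        map_smul' := by
          intro r z
          ext x
          simp only [AlternatingMap.sub_apply, AlternatingMap.smul_apply, ha, map_smul, dFun_smul,
            lieCochain_apply, smul_lie, AlternatingMap.map_update_smul, RingHom.id_apply,
            ← Finset.smul_sum, smul_sub] }
    have hF0 : ∀ (y : L) (v : Fin (n + 1) → L), v 0 = y → F y v = 0 := by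
      intro y v hv
      change lieCochain y c v - a (c.curryLeft y) v = 0
      have h1 : lieCochain y c v = lieCochain y (c.curryLeft y) (Fin.tail v) := by
        have h := congrArg (fun f => f (Fin.tail v)) (lieCochain_curryLeft y y c)
        simp only [lie_self, map_zero, sub_zero, AlternatingMap.curryLeft_apply_apply] at h
        rw [← h]
        congr 1
        rw [← hv]
        exact (Fin.cons_self_tail v).symm
      rw [h1, ha]
      cases n with
      | zero =>
        rw [dFun_zero, hv, lieCochain_apply]
        simp only [Finset.univ_eq_empty, Finset.sum_empty, sub_zero]
        rw [Subsingleton.elim (Fin.tail v) ![], sub_self]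
      | succ n =>
        rw [dFun_succ, hv, AlternatingMap.curryLeft_same]
        have : dFun (0 : L [⋀^Fin n]→ₗ[K] M) (Fin.tail v) = 0 := by simp [dFun]
        rw [this, sub_zero, sub_self]
    obtain ⟨b, hb⟩ := exists_alt_uncurry F (by
      intro y v j hv
      rcases eq_or_ne j 0 with rfl | hj
      · exact hF0 y v hv
      · have := (F y).map_swap v hj
        rw [← neg_eq_zero, ← this]
        refine hF0 _ _ ?_
        simp [hv])
    refine ⟨b, fun x => ?_⟩
    rw [hb, dFun_succ, ← ha]
    rfl

/-- The Chevalley–Eilenberg differential. -/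
def d (n : ℕ) : (L [⋀^Fin n]→ₗ[K] M) →ₗ[K] (L [⋀^Fin (n + 1)]→ₗ[K] M) where
  toFun c :=
    { toFun := dFun c
      map_update_add' := by
        intro inst x i a b
        obtain ⟨f, hf⟩ := exists_d c
        simp only [← hf, AlternatingMap.map_update_add]
      map_update_smul' := by
        intro inst x i a b
        obtain ⟨f, hf⟩ := exists_d c
        simp only [← hf, AlternatingMap.map_update_smul]
      map_eq_zero_of_eq' := by
        intro x i j h hij
        obtain ⟨f, hf⟩ := exists_d c
        simp only [← hf]
        exact f.map_eq_zero_of_eq x h hij }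
  map_add' c c' := AlternatingMap.ext fun x => dFun_add c c' x
  map_smul' r c := AlternatingMap.ext fun x => dFun_smul r c x

theorem d_apply {n : ℕ} (c : L [⋀^Fin n]→ₗ[K] M) (x : Fin (n + 1) → L) :
    d n c x = ∑ i : Fin (n + 1), (-1 : K) ^ (i : ℕ) •
      (⁅x i, c (i.removeNth x)⁆
        - ∑ j ∈ Finset.Ioi i, c (i.removeNth (Function.update x j ⁅x i, x j⁆))) := rfl

theorem curryLeft_ext {n : ℕ} {a b : L [⋀^Fin (n + 1)]→ₗ[K] M}
    (h : ∀ y, a.curryLeft y = b.curryLeft y) : a = b := by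
  ext x
  have := congrArg (fun f => f (Fin.tail x)) (h (x 0))
  simp only [AlternatingMap.curryLeft_apply_apply] at this
  rwa [show Matrix.vecCons (x 0) (Fin.tail x) = x from Fin.cons_self_tail x] at this

theorem d_curryLeft {n : ℕ} (c : L [⋀^Fin (n + 1)]→ₗ[K] M) (y : L) :
    (d (n + 1) c).curryLeft y = lieCochain y c - d n (c.curryLeft y) := by
  ext x
  exact dFun_succ c (Matrix.vecCons y x)

theorem d_zero_curryLeft (c : L [⋀^Fin 0]→ₗ[K] M) (y : L) :
    (d 0 c).curryLeft y = lieCochain y c := by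
  ext x
  refine (dFun_zero c (Matrix.vecCons y x)).trans ?_
  rw [lieCochain_apply]
  simp only [Finset.univ_eq_empty, Finset.sum_empty, sub_zero]
  rw [Subsingleton.elim x ![]]
  rfl

theorem lieCochain_add {n : ℕ} (z : L) (c c' : L [⋀^Fin n]→ₗ[K] M) :
    lieCochain z (c + c') = lieCochain z c + lieCochain z c' := by
  ext x
  simp only [lieCochain_apply, AlternatingMap.add_apply, lie_add, Finset.sum_add_distrib]
  abel

theorem lieCochain_sub {n : ℕ} (z : L) (c c' : L [⋀^Fin n]→ₗ[K] M) :
    lieCochain z (c - c') = lieCochain z c - lieCochain z c' := by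
  ext x
  simp only [lieCochain_apply, AlternatingMap.sub_apply, lie_sub, Finset.sum_sub_distrib]
  abel

theorem lieCochain_comm {n : ℕ} (y z : L) (c : L [⋀^Fin n]→ₗ[K] M) :
    lieCochain y (lieCochain z c) - lieCochain z (lieCochain y c) = lieCochain ⁅y, z⁆ c := by
  induction n with
  | zero =>
    ext x
    simp [lieCochain_apply]
  | succ n ih =>
    refine curryLeft_ext fun w => ?_
    rw [← AlternatingMap.curryLeftLinearMap_apply, map_sub, LinearMap.sub_apply]
    simp only [AlternatingMap.curryLeftLinearMap_apply, lieCochain_curryLeft, lieCochain_sub,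
      ← ih, lie_lie, map_sub]
    abel

theorem lieCochain_d {n : ℕ} (z : L) (c : L [⋀^Fin n]→ₗ[K] M) :
    lieCochain z (d n c) = d n (lieCochain z c) := by
  induction n with
  | zero =>
    refine curryLeft_ext fun w => ?_
    rw [lieCochain_curryLeft, d_zero_curryLeft, d_zero_curryLeft, d_zero_curryLeft,
      ← lieCochain_comm]
    abel
  | succ n ih =>
    refine curryLeft_ext fun w => ?_
    simp only [lieCochain_curryLeft, d_curryLeft, lieCochain_sub, ih, map_sub,
      ← lieCochain_comm z w]
    abel

/-- The differential squares to zero. -/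
theorem d_d {n : ℕ} (c : L [⋀^Fin n]→ₗ[K] M) : d (n + 1) (d n c) = 0 := by
  induction n with
  | zero =>
    refine curryLeft_ext fun w => ?_
    rw [d_curryLeft, d_zero_curryLeft, lieCochain_d, sub_self, AlternatingMap.curryLeft_zero]
    rfl
  | succ n ih =>
    refine curryLeft_ext fun w => ?_
    rw [d_curryLeft, d_curryLeft, map_sub, ih, lieCochain_d, sub_zero, sub_self,
      AlternatingMap.curryLeft_zero]
    rfl


section Cohomology

variable (K L M)

/-- `n`-cocycles of `L` with coefficients in `M`. -/
def cocycles (n : ℕ) : Submodule K (L [⋀^Fin n]→ₗ[K] M) := LinearMap.ker (d n)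

/-- `n`-coboundaries of `L` with coefficients in `M` (none but `0` in degree `0`). -/
def coboundaries : (n : ℕ) → Submodule K (L [⋀^Fin n]→ₗ[K] M)
  | 0 => ⊥
  | n + 1 => LinearMap.range (d n)

/-- The cohomology space `Hⁿ(L, M)`: cocycles modulo coboundaries. -/
abbrev H (n : ℕ) : Type _ :=
  cocycles K L M n ⧸ (coboundaries K L M n).submoduleOf (cocycles K L M n)

variable {K L M}

/-- The class of a cocycle. -/
def cls {n : ℕ} (c : L [⋀^Fin n]→ₗ[K] M) (hc : c ∈ cocycles K L M n) : H K L M n :=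
  Submodule.Quotient.mk ⟨c, hc⟩

end Cohomology

section Connecting

variable {A B C : Type*}
  [AddCommGroup A] [Module K A] [LieRingModule L A] [LieModule K L A]
  [AddCommGroup B] [Module K B] [LieRingModule L B] [LieModule K L B]
  [AddCommGroup C] [Module K C] [LieRingModule L C] [LieModule K L C]

theorem d_comp {n : ℕ} (f : A →ₗ⁅K,L⁆ B) (c : L [⋀^Fin n]→ₗ[K] A) :
    d n ((f : A →ₗ[K] B).compAlternatingMap c) = (f : A →ₗ[K] B).compAlternatingMap (d n c) := by
  ext x
  simp [d_apply, map_sub]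

variable (i : A →ₗ⁅K,L⁆ B) (p : B →ₗ⁅K,L⁆ C)

/-- A linear section of `p`. -/
def linSection (hp : Function.Surjective p) : C →ₗ[K] B :=
  ((p : B →ₗ[K] C).exists_rightInverse_of_surjective (LinearMap.range_eq_top.2 hp)).choose

theorem linSectionspec (hp : Function.Surjective p) (c : C) : p (linSection p hp c) = c :=
  LinearMap.congr_fun ((p : B →ₗ[K] C).exists_rightInverse_of_surjective
    (LinearMap.range_eq_top.2 hp)).choose_spec c

/-- A linear retraction of `i`. -/
def retr (hi : Function.Injective i) : B →ₗ[K] A :=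
  ((i : A →ₗ[K] B).exists_leftInverse_of_injective (LinearMap.ker_eq_bot.2 hi)).choose

theorem retr_spec (hi : Function.Injective i) (a : A) : retr i hi (i a) = a :=
  LinearMap.congr_fun ((i : A →ₗ[K] B).exists_leftInverse_of_injective
    (LinearMap.ker_eq_bot.2 hi)).choose_spec a

variable {i p} (hi : Function.Injective i) (hp : Function.Surjective p)

theorem comp_retr {n : ℕ} (hex : Function.Exact i p) (b : L [⋀^Fin n]→ₗ[K] B)
    (hb : (p : B →ₗ[K] C).compAlternatingMap b = 0) :
    (i : A →ₗ[K] B).compAlternatingMap ((retr i hi).compAlternatingMap b) = b := by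
  ext x
  obtain ⟨a, ha⟩ := (hex (b x)).1 (AlternatingMap.congr_fun hb x)
  change i (retr i hi (b x)) = b x
  rw [← ha, retr_spec]

theorem comp_inj {n : ℕ} (hi : Function.Injective i) {a a' : L [⋀^Fin n]→ₗ[K] A}
    (h : (i : A →ₗ[K] B).compAlternatingMap a = (i : A →ₗ[K] B).compAlternatingMap a') : a = a' :=
  AlternatingMap.ext fun x => hi (AlternatingMap.congr_fun h x)

/-- Lift the cochain along `p`, apply the differential, pull back along `i`. -/
def connCochain (n : ℕ) : (L [⋀^Fin n]→ₗ[K] C) →ₗ[K] (L [⋀^Fin (n + 1)]→ₗ[K] A) where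
  toFun c := (retr i hi).compAlternatingMap (d n ((linSection p hp).compAlternatingMap c))
  map_add' c c' := by
    have h : (linSection p hp).compAlternatingMap (c + c') = (linSection p hp).compAlternatingMap c
      + (linSection p hp).compAlternatingMap c' := by ext; simp
    rw [h, map_add]
    ext; simp
  map_smul' r c := by
    have h : (linSection p hp).compAlternatingMap (r • c)
      = r • (linSection p hp).compAlternatingMap c := by ext; simp
    rw [h, map_smul]
    ext; simp

theorem comp_connCochain {n : ℕ} (hex : Function.Exact i p) (c : L [⋀^Fin n]→ₗ[K] C) (hc : d n c = 0) :
    (i : A →ₗ[K] B).compAlternatingMap (connCochain (i := i) hi hp n c)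
      = d n ((linSection p hp).compAlternatingMap c) := by
  refine comp_retr hi hex _ ?_
  rw [← d_comp, ← hc]
  congr 1
  ext x
  exact linSectionspec p hp _

theorem connCochain_mem {n : ℕ} (hex : Function.Exact i p) (c : L [⋀^Fin n]→ₗ[K] C) (hc : c ∈ cocycles K L C n) :
    connCochain (i := i) hi hp n c ∈ cocycles K L A (n + 1) := by
  refine comp_inj hi ?_
  rw [← d_comp, comp_connCochain hi hp hex c hc, d_d]
  ext
  simp

theorem conn_coboundary {n : ℕ} (hi : Function.Injective i)
    (hex : Function.Exact i p) (b : L [⋀^Fin n]→ₗ[K] B) (a : L [⋀^Fin (n + 1)]→ₗ[K] A)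
    (hb : (p : B →ₗ[K] C).compAlternatingMap b ∈ coboundaries K L C n)
    (ha : (i : A →ₗ[K] B).compAlternatingMap a = d n b) (hp : Function.Surjective p) :
    a ∈ coboundaries K L A (n + 1) := by
  have key : ∀ b' : L [⋀^Fin n]→ₗ[K] B, d n b' = 0 →
      (p : B →ₗ[K] C).compAlternatingMap (b - b') = 0 → a ∈ coboundaries K L A (n + 1) := by
    intro b' hb' h
    refine ⟨(retr i hi).compAlternatingMap (b - b'), comp_inj hi ?_⟩
    rw [← d_comp, comp_retr hi hex _ h, map_sub, hb', sub_zero, ha]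
  cases n with
  | zero => exact key 0 (map_zero _) (by rw [sub_zero]; exact hb)
  | succ n =>
    obtain ⟨y, hy⟩ := hb
    refine key (d n ((linSection p hp).compAlternatingMap y)) (d_d _) ?_
    have h1 : (p : B →ₗ[K] C).compAlternatingMap (d n ((linSection p hp).compAlternatingMap y))
        = d n y := by
      rw [← d_comp]
      congr 1
      ext x
      exact linSectionspec p hp _
    ext x
    have h2 := AlternatingMap.congr_fun (h1.trans hy) x
    simp only [LinearMap.compAlternatingMap_apply, AlternatingMap.sub_apply, map_sub] at h2 ⊢
    rw [h2, sub_self]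
    rfl

/-- The connecting homomorphism `Hⁿ(L, C) → Hⁿ⁺¹(L, A)` of a short exact sequence
`0 → A → B → C → 0` of `L`-modules. -/
def connecting (hex : Function.Exact i p) (n : ℕ) : H K L C n →ₗ[K] H K L A (n + 1) :=
  Submodule.mapQ _ _
    ((connCochain (i := i) hi hp n).restrict fun c hc => connCochain_mem hi hp hex c hc) <| by
    intro c hc
    refine conn_coboundary hi hex ((linSection p hp).compAlternatingMap c.1) _ ?_
      (comp_connCochain hi hp hex c.1 c.2) hp
    convert (show c.1 ∈ coboundaries K L C n from hc)
    ext x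
    exact linSectionspec p hp _

/-- `connecting` is computed by lifting a cocycle `c` of `C` to any cochain `b` of `B`:
its value on the class of `c` is the class of the cocycle `a` of `A` such that `i a = d b`. -/
theorem connecting_cls (hex : Function.Exact i p) {n : ℕ}
    (c : L [⋀^Fin n]→ₗ[K] C) (hc : c ∈ cocycles K L C n)
    (b : L [⋀^Fin n]→ₗ[K] B) (hb : (p : B →ₗ[K] C).compAlternatingMap b = c)
    (a : L [⋀^Fin (n + 1)]→ₗ[K] A) (ha : (i : A →ₗ[K] B).compAlternatingMap a = d n b)
    (hac : a ∈ cocycles K L A (n + 1)) :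
    connecting hi hp hex n (cls c hc) = cls a hac := by
  refine (Submodule.Quotient.eq _).2 ?_
  refine conn_coboundary hi hex ((linSection p hp).compAlternatingMap c - b) _ ?_ ?_ hp
  · convert Submodule.zero_mem (coboundaries K L C n)
    ext x
    have h2 := AlternatingMap.congr_fun hb x
    simp only [LinearMap.compAlternatingMap_apply, AlternatingMap.sub_apply, map_sub] at h2 ⊢
    rw [h2]
    exact sub_eq_zero.2 (linSectionspec p hp _)
  · refine Eq.trans ?_ (map_sub (d n) _ _).symm
    rw [← comp_connCochain hi hp hex c hc, ← ha]
    ext x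
    exact map_sub i _ _

end Connecting

end CE

/-! ### Representations of `gl(m, ℝ)`, tensor fields on `ℝ^m`, and Lie derivatives -/

/-- The space `ℝ^m`. -/
abbrev Eu (m : ℕ) : Type := Fin m → ℝ

/-- `gl(m, ℝ)`, the endomorphisms of `ℝ^m`. -/
abbrev Gl (m : ℕ) : Type := Eu m →L[ℝ] Eu m

/-- The dual `ℝ^{m*}`. -/
abbrev Cov (m : ℕ) : Type := Eu m →L[ℝ] ℝ

/-- `∧^p ℝ^m`: skewsymmetric contravariant tensors of degree `p`, i.e. alternating `p`-linear
forms on `ℝ^{m*}`. -/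
abbrev Lam (m p : ℕ) : Type := Cov m [⋀^Fin p]→L[ℝ] ℝ

/-- A (continuous) representation of the Lie algebra `gl(m, ℝ)` on `V`. -/
class GlRep (m : ℕ) (V : Type) [NormedAddCommGroup V] [NormedSpace ℝ V] where
  act : Gl m →L[ℝ] V →L[ℝ] V
  act_comm : ∀ (A B : Gl m) (v : V), act (A * B - B * A) v = act A (act B v) - act B (act A v)

section Reps

variable {m : ℕ} {V W : Type} [NormedAddCommGroup V] [NormedSpace ℝ V]
  [NormedAddCommGroup W] [NormedSpace ℝ W]

/-- The dual of the standard representation: `ρ(A) η = - η ∘ A`. -/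
instance glRepCov : GlRep m (Cov m) where
  act := -(ContinuousLinearMap.compL ℝ (Eu m) (Eu m) ℝ).flip
  act_comm A B η := by ext x; simp

/-- The representation on `Hom(V, W)`: `ρ(A) h = ρ_W(A) ∘ h - h ∘ ρ_V(A)`. -/
instance glRepHom [GlRep m V] [GlRep m W] : GlRep m (V →L[ℝ] W) where
  act := (ContinuousLinearMap.compL ℝ V W W).comp GlRep.act
    - ((ContinuousLinearMap.compL ℝ V V W).flip).comp GlRep.act
  act_comm A B h := by
    ext x
    have h1 := GlRep.act_comm A B (h x)
    have h2 := congrArg h (GlRep.act_comm A B x)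
    simp only [map_sub, _root_.sub_apply] at h1 h2
    simp only [map_sub, _root_.sub_apply, ContinuousLinearMap.comp_apply,
      ContinuousLinearMap.flip_apply, ContinuousLinearMap.compL_apply]
    rw [sub_sub_sub_comm, h1, h2]
    abel

theorem glRepCov_apply (A : Gl m) (η : Cov m) (x : Eu m) :
    GlRep.act A η x = - η (A x) := rfl

theorem glRepHom_apply [GlRep m V] [GlRep m W] (A : Gl m) (h : V →L[ℝ] W) (v : V) :
    GlRep.act A h v = GlRep.act A (h v) - h (GlRep.act A v) := rfl

theorem altDer_comm {R L N : Type*} [CommRing R] [AddCommGroup L] [Module R L] [AddCommGroup N]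
    [Module R N] (D D' : L →ₗ[R] L) {n : ℕ} (c : L [⋀^Fin n]→ₗ[R] N) :
    altDer D (altDer D' c) - altDer D' (altDer D c) = altDer (D' ∘ₗ D - D ∘ₗ D') c := by
  ext x
  have h : ∀ D D' : L →ₗ[R] L, altDer D (altDer D' c) x
      = ∑ i, c (Function.update x i (D' (D (x i)))) + ∑ i, ∑ j ∈ Finset.univ.erase i,
        c (Function.update (Function.update x i (D (x i))) j (D' (x j))) := by
    intro D D'
    simp only [altDer_apply]
    rw [← Finset.sum_add_distrib]
    refine Finset.sum_congr rfl fun i _ => ?_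
    rw [← Finset.add_sum_erase _ _ (Finset.mem_univ i)]
    congr 1
    · simp only [Function.update_self, Function.update_idem]
    · refine Finset.sum_congr rfl fun j hj => ?_
      rw [Function.update_of_ne (Finset.ne_of_mem_erase hj)]
  have h2 : ∑ i, ∑ j ∈ Finset.univ.erase i,
        c (Function.update (Function.update x i (D (x i))) j (D' (x j)))
      = ∑ i, ∑ j ∈ Finset.univ.erase i,
        c (Function.update (Function.update x i (D' (x i))) j (D (x j))) := by
    rw [Finset.sum_comm' (t' := Finset.univ) (s' := fun j => Finset.univ.erase j)
      (by intro i j; simp [ne_comm])]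
    refine Finset.sum_congr rfl fun j _ => Finset.sum_congr rfl fun i hi => ?_
    rw [Function.update_comm (Finset.ne_of_mem_erase hi)]
  rw [AlternatingMap.sub_apply, h, h, h2, altDer_apply]
  simp only [LinearMap.sub_apply, LinearMap.comp_apply, AlternatingMap.map_update_sub,
    Finset.sum_sub_distrib]
  abel

/-- The canonical action of `gl(m, ℝ)` on `∧^p ℝ^m`, extending the standard one as a derivation:
`(ρ(A) T)(β₁, …, β_p) = ∑ i, T (β₁, …, βᵢ ∘ A, …, β_p)`. (This is the derivative at the identity
of the action of the linear group, which is how it is bundled here.) -/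
def lamAct (m p : ℕ) : Gl m →L[ℝ] Lam m p →L[ℝ] Lam m p :=
  (ContinuousAlternatingMap.fderivCompContinuousLinearMapCLM ℝ
    (ContinuousLinearMap.id ℝ (Cov m))).flip.comp
    (ContinuousLinearMap.compL ℝ (Eu m) (Eu m) ℝ).flip

theorem lamAct_apply {p : ℕ} (A : Gl m) (T : Lam m p) (β : Fin p → Cov m) :
    lamAct m p A T β = ∑ i, T (Function.update β i ((β i).comp A)) := by
  refine (ContinuousAlternatingMap.fderivCompContinuousLinearMap_apply T _ _ β).trans ?_
  refine Finset.sum_congr rfl fun i _ => congrArg T ?_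
  funext j
  rcases eq_or_ne j i with rfl | h
  · simp
  · simp [h]

instance glRepLam (p : ℕ) : GlRep m (Lam m p) where
  act := lamAct m p
  act_comm A B T := by
    let D : Gl m → Cov m →ₗ[ℝ] Cov m := fun A =>
      ((ContinuousLinearMap.compL ℝ (Eu m) (Eu m) ℝ).flip A : Cov m →L[ℝ] Cov m)
    have h : ∀ (A : Gl m) (T : Lam m p),
        (lamAct m p A T).toAlternatingMap = altDer (D A) T.toAlternatingMap := by
      intro A T
      ext β
      exact lamAct_apply A T β
    apply ContinuousAlternatingMap.toAlternatingMap_injective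
    have hs : ∀ T T' : Lam m p, (T - T').toAlternatingMap
      = T.toAlternatingMap - T'.toAlternatingMap := fun _ _ => rfl
    rw [hs, h, h, h, h, h, altDer_comm]
    congr 1
    ext β x
    simp [D]

end Reps

theorem two_le_infty : (2 : WithTop ℕ∞) ≤ ∞ := WithTop.coe_le_coe.2 le_top

section Fields

variable (m : ℕ) (V : Type) [NormedAddCommGroup V] [NormedSpace ℝ V]

/-- The smooth maps `ℝ^m → V`, as a subspace of all maps. -/
def smoothMaps : Submodule ℝ (Eu m → V) where
  carrier := {f | ContDiff ℝ ∞ f}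
  add_mem' {f g} (hf : ContDiff ℝ ∞ f) (hg : ContDiff ℝ ∞ g) := hf.add hg
  zero_mem' := (contDiff_const : ContDiff ℝ ∞ fun _ : Eu m => (0 : V))
  smul_mem' r f (hf : ContDiff ℝ ∞ f) := hf.const_smul r

/-- `C^∞(ℝ^m, V)`. -/
def Sec : Type := smoothMaps m V

instance : AddCommGroup (Sec m V) := inferInstanceAs (AddCommGroup (smoothMaps m V))
instance : Module ℝ (Sec m V) := inferInstanceAs (Module ℝ (smoothMaps m V))
instance : CoeFun (Sec m V) (fun _ => Eu m → V) := ⟨fun f => f.1⟩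

/-- The vector fields on `ℝ^m`. -/
abbrev Vect : Type := Sec m (Eu m)

variable {m V}

/-- A smooth map as an element of `C^∞(ℝ^m, V)`. -/
def Sec.mk (f : Eu m → V) (hf : ContDiff ℝ ∞ f) : Sec m V := ⟨f, hf⟩

namespace Sec

@[ext] theorem ext {f g : Sec m V} (h : ∀ x, f x = g x) : f = g := Subtype.ext (funext h)
@[simp] theorem mk_apply (f : Eu m → V) (hf : ContDiff ℝ ∞ f) (x : Eu m) :
    Sec.mk f hf x = f x := rfl
@[simp] theorem add_apply (f g : Sec m V) (x : Eu m) : (f + g) x = f x + g x := rfl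
@[simp] theorem sub_apply (f g : Sec m V) (x : Eu m) : (f - g) x = f x - g x := rfl
@[simp] theorem neg_apply (f : Sec m V) (x : Eu m) : (-f) x = - f x := rfl
@[simp] theorem zero_apply (x : Eu m) : (0 : Sec m V) x = 0 := rfl
@[simp] theorem smul_apply (r : ℝ) (f : Sec m V) (x : Eu m) : (r • f) x = r • f x := rfl

theorem smooth (f : Sec m V) : ContDiff ℝ ∞ f.1 := f.2
theorem diff (f : Sec m V) : Differentiable ℝ f.1 := f.smooth.differentiable (by simp)
theorem smooth_fderiv (f : Sec m V) : ContDiff ℝ ∞ (fderiv ℝ f.1) :=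
  f.smooth.fderiv_right (by simp)
theorem diff_fderiv (f : Sec m V) : Differentiable ℝ (fderiv ℝ f.1) :=
  f.smooth_fderiv.differentiable (by simp)

theorem fderiv_add (f g : Sec m V) (x : Eu m) :
    fderiv ℝ (f + g).1 x = fderiv ℝ f.1 x + fderiv ℝ g.1 x :=
  _root_.fderiv_add (f.diff x) (g.diff x)

theorem fderiv_smul (r : ℝ) (f : Sec m V) (x : Eu m) :
    fderiv ℝ (r • f).1 x = r • fderiv ℝ f.1 x :=
  fderiv_const_smul (f.diff x) r

theorem fderiv_symm (f : Sec m V) (x v w : Eu m) :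
    fderiv ℝ (fderiv ℝ f.1) x v w = fderiv ℝ (fderiv ℝ f.1) x w v :=
  (f.smooth.contDiffAt.isSymmSndFDerivAt (by simpa using two_le_infty)) v w

end Sec

/-- The Lie algebra structure of `Vect(ℝ^m)`: `[X, Y](x) = DY(x) X(x) - DX(x) Y(x)`. -/
instance : LieRing (Vect m) where
  bracket X Y := Sec.mk (VectorField.lieBracket ℝ X.1 Y.1)
    (X.smooth.lieBracket_vectorField Y.smooth (by simp))
  add_lie X Y Z := Sec.ext fun x =>
    VectorField.lieBracket_add_left (X.diff x) (Y.diff x)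
  lie_add X Y Z := Sec.ext fun x =>
    VectorField.lieBracket_add_right (Y.diff x) (Z.diff x)
  lie_self X := Sec.ext fun x => congrFun VectorField.lieBracket_self x
  leibniz_lie X Y Z := Sec.ext fun x =>
    VectorField.leibniz_identity_lieBracket (n := ∞) (by simpa using two_le_infty) X.smooth.contDiffAt
      Y.smooth.contDiffAt Z.smooth.contDiffAt

theorem Vect.lie_apply (X Y : Vect m) (x : Eu m) :
    (⁅X, Y⁆ : Vect m) x = fderiv ℝ Y.1 x (X x) - fderiv ℝ X.1 x (Y x) := rfl

instance : LieAlgebra ℝ (Vect m) where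
  lie_smul _ _ Y := Sec.ext fun x => VectorField.lieBracket_const_smul_right (Y.diff x)

theorem Vect.fderiv_lie (X Y : Vect m) (x : Eu m) :
    fderiv ℝ (⁅X, Y⁆ : Vect m).1 x = fderiv ℝ (fderiv ℝ Y.1) x (X x)
      - fderiv ℝ (fderiv ℝ X.1) x (Y x)
      - (fderiv ℝ X.1 x * fderiv ℝ Y.1 x - fderiv ℝ Y.1 x * fderiv ℝ X.1 x) := by
  have h := ((Y.diff_fderiv x).hasFDerivAt.clm_apply (X.diff x).hasFDerivAt).sub
    ((X.diff_fderiv x).hasFDerivAt.clm_apply (Y.diff x).hasFDerivAt)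
  have h' : fderiv ℝ (⁅X, Y⁆ : Vect m).1 x = _ := h.fderiv
  rw [h']
  ext1 v
  simp only [_root_.sub_apply, _root_.add_apply,
    ContinuousLinearMap.comp_apply, ContinuousLinearMap.flip_apply, ContinuousLinearMap.mul_def,
    Y.fderiv_symm x v, X.fderiv_symm x v]
  abel

section LieDer

variable [GlRep m V]

theorem Sec.hasFDerivAt_act (X : Vect m) (f : Sec m V) (x : Eu m) :
    HasFDerivAt (fun y => GlRep.act (fderiv ℝ X.1 y) (f y))
      ((GlRep.act (fderiv ℝ X.1 x)).comp (fderiv ℝ f.1 x)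
        + ((GlRep.act (m := m) (V := V)).comp (fderiv ℝ (fderiv ℝ X.1) x)).flip (f x)) x :=
  ((GlRep.act (m := m) (V := V)).hasFDerivAt.comp x (X.diff_fderiv x).hasFDerivAt).clm_apply
    (f.diff x).hasFDerivAt

/-- The Lie derivative `L_X f = X.f - ρ(DX) f` on `C^∞(ℝ^m, V)`. -/
def lieDer (X : Vect m) (f : Sec m V) : Sec m V :=
  Sec.mk (fun x => fderiv ℝ f.1 x (X x) - GlRep.act (fderiv ℝ X.1 x) (f x))
    ((f.smooth_fderiv.clm_apply X.smooth).sub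
      (((GlRep.act (m := m) (V := V)).contDiff.comp X.smooth_fderiv).clm_apply f.smooth))

theorem lieDer_apply (X : Vect m) (f : Sec m V) (x : Eu m) :
    lieDer X f x = fderiv ℝ f.1 x (X x) - GlRep.act (fderiv ℝ X.1 x) (f x) := rfl

theorem fderiv_lieDer (X : Vect m) (f : Sec m V) (x v : Eu m) :
    fderiv ℝ (lieDer X f).1 x v = fderiv ℝ (fderiv ℝ f.1) x v (X x)
      + fderiv ℝ f.1 x (fderiv ℝ X.1 x v)
      - (GlRep.act (fderiv ℝ X.1 x) (fderiv ℝ f.1 x v)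
        + GlRep.act (fderiv ℝ (fderiv ℝ X.1) x v) (f x)) := by
  have h := ((f.diff_fderiv x).hasFDerivAt.clm_apply (X.diff x).hasFDerivAt).sub
    (Sec.hasFDerivAt_act X f x)
  have h' : fderiv ℝ (lieDer X f).1 x = _ := h.fderiv
  rw [h']
  simp only [_root_.sub_apply, _root_.add_apply,
    ContinuousLinearMap.comp_apply, ContinuousLinearMap.flip_apply]
  abel

instance : LieRingModule (Vect m) (Sec m V) where
  bracket := lieDer
  add_lie X Y f := by
    ext x
    simp only [lieDer_apply, Sec.add_apply, Sec.fderiv_add, map_add,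
      _root_.add_apply]
    abel
  lie_add X f g := by
    ext x
    simp only [lieDer_apply, Sec.add_apply, Sec.fderiv_add, map_add,
      _root_.add_apply]
    abel
  leibniz_lie X Y f := by
    ext x
    change lieDer X (lieDer Y f) x = (lieDer ⁅X, Y⁆ f + lieDer Y (lieDer X f)) x
    have hc := GlRep.act_comm (fderiv ℝ X.1 x) (fderiv ℝ Y.1 x) (f x)
    rw [Sec.add_apply, lieDer_apply X, fderiv_lieDer, lieDer_apply Y (lieDer X f), fderiv_lieDer,
      lieDer_apply ⁅X, Y⁆, Vect.lie_apply, Vect.fderiv_lie, lieDer_apply, lieDer_apply,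
      f.fderiv_symm x (Y x) (X x), map_sub GlRep.act, _root_.sub_apply, hc]
    simp only [map_sub, _root_.sub_apply]
    abel

theorem Sec.lie_apply (X : Vect m) (f : Sec m V) (x : Eu m) :
    (⁅X, f⁆ : Sec m V) x = fderiv ℝ f.1 x (X x) - GlRep.act (fderiv ℝ X.1 x) (f x) := rfl

instance : LieModule ℝ (Vect m) (Sec m V) where
  smul_lie r X f := by
    ext x
    simp only [Sec.lie_apply, Sec.smul_apply, Sec.fderiv_smul, map_smul, smul_sub,
      _root_.smul_apply]
  lie_smul r X f := by
    ext x
    simp only [Sec.lie_apply, Sec.smul_apply, Sec.fderiv_smul, map_smul, smul_sub,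
      _root_.smul_apply]

end LieDer

end Fields

/-! ### The algebra `sl_{m+1}` of projective vector fields -/

section Projective

variable {m : ℕ}

/-- The constant vector field `h^* = - h^i ∂_i`. -/
def hField (h : Eu m) : Vect m := Sec.mk (fun _ => -h) contDiff_const

/-- The linear vector field `A^* = - A^i_j x^j ∂_i`. -/
def AField (A : Gl m) : Vect m := Sec.mk (fun x => -(A x)) A.contDiff.neg

/-- The quadratic vector field `α^* = α(x) x^i ∂_i`. -/
def αField (α : Cov m) : Vect m := Sec.mk (fun x => α x • x) (α.contDiff.smul contDiff_id)

theorem fderiv_projField (h : Eu m) (A : Gl m) (α : Cov m) (x v : Eu m) :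
    fderiv ℝ (hField h + AField A + αField α).1 x v = -(A v) + (α v • x + α x • v) := by
  have h1 := (((hasFDerivAt_const (-h) x).add (A.hasFDerivAt (x := x)).neg).add
    ((α.hasFDerivAt (x := x)).smul (hasFDerivAt_id x)))
  have h2 : fderiv ℝ (hField h + AField A + αField α).1 x = _ := h1.fderiv
  rw [h2]
  simp [add_comm]

variable (m)

/-- The realization `sl_{m+1}` of `sl(m+1, ℝ) = ℝ^m ⊕ gl(m, ℝ) ⊕ ℝ^{m*}` as a Lie subalgebra of
`Vect(ℝ^m)`: the vector fields `h^* + A^* + α^*`. -/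
def slProj : LieSubalgebra ℝ (Vect m) where
  carrier := {X | ∃ (h : Eu m) (A : Gl m) (α : Cov m), X = hField h + AField A + αField α}
  add_mem' := by
    rintro _ _ ⟨h, A, α, rfl⟩ ⟨h', A', α', rfl⟩
    refine ⟨h + h', A + A', α + α', Sec.ext fun x => ?_⟩
    simp only [hField, AField, αField, Sec.add_apply, Sec.mk_apply, _root_.add_apply, add_smul]
    abel
  zero_mem' := ⟨0, 0, 0, Sec.ext fun x => by simp [hField, AField, αField]⟩
  smul_mem' := by
    rintro r _ ⟨h, A, α, rfl⟩
    refine ⟨r • h, r • A, r • α, Sec.ext fun x => ?_⟩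
    simp [hField, AField, αField, mul_smul]
  lie_mem' := by
    rintro _ _ ⟨h, A, α, rfl⟩ ⟨h', A', α', rfl⟩
    refine ⟨A h' - A' h, A * A' - A' * A
        + (α' h • ContinuousLinearMap.id ℝ (Eu m) + α'.smulRight h)
        - (α h' • ContinuousLinearMap.id ℝ (Eu m) + α.smulRight h'),
      α.comp A' - α'.comp A, Sec.ext fun x => ?_⟩
    rw [Vect.lie_apply, fderiv_projField, fderiv_projField]
    simp only [hField, AField, αField, Sec.add_apply, Sec.mk_apply, map_add, map_neg, map_smul,
      _root_.add_apply, _root_.sub_apply, _root_.smul_apply, ContinuousLinearMap.comp_apply,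
      ContinuousLinearMap.mul_def, ContinuousLinearMap.smulRight_apply,
      ContinuousLinearMap.id_apply, smul_eq_mul]
    module

end Projective

/-! ### Differential operators of order at most one and their symbols -/

section DiffOp

variable {m : ℕ} {V W : Type} [NormedAddCommGroup V] [NormedSpace ℝ V]
  [NormedAddCommGroup W] [NormedSpace ℝ W]

/-- The `i`-th vector of the canonical basis of `ℝ^m`. -/
abbrev ebasis (i : Fin m) : Eu m := Pi.single i 1

/-- The coordinate form `dx^i`. -/
abbrev dx (i : Fin m) : Cov m := ContinuousLinearMap.proj i

theorem Eu.eq_sum (v : Eu m) : v = ∑ i, dx i v • ebasis i := by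
  ext j
  simp [Finset.sum_apply, Pi.single_apply]

theorem Cov.eq_sum (η : Cov m) : η = ∑ i, η (ebasis i) • dx i := by
  ext v
  conv_lhs => rw [Eu.eq_sum v]
  simp [mul_comm]

theorem sum_transpose {F : Type} [AddCommGroup F] [Module ℝ F] (b : Cov m →ₗ[ℝ] Eu m →ₗ[ℝ] F)
    (A : Gl m) :
    ∑ i, b (dx i) (A (ebasis i)) = ∑ i, b ((dx i).comp A) (ebasis i) := by
  have h1 : ∀ i, b (dx i) (A (ebasis i)) = ∑ j, dx j (A (ebasis i)) • b (dx i) (ebasis j) := by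
    intro i
    conv_lhs => rw [Eu.eq_sum (A (ebasis i))]
    simp only [map_sum, map_smul]
  have h2 : ∀ i, b ((dx i).comp A) (ebasis i)
      = ∑ j, dx i (A (ebasis j)) • b (dx j) (ebasis i) := by
    intro i
    conv_lhs => rw [Cov.eq_sum ((dx i).comp A)]
    simp only [map_sum, map_smul, LinearMap.sum_apply, LinearMap.smul_apply,
      ContinuousLinearMap.comp_apply]
  simp only [h1, h2]
  exact Finset.sum_comm

/-- The operator `f ↦ a(f) + ∑ i, s(dx^i)(∂_i f)`. -/
def op (a : Sec m (V →L[ℝ] W)) (s : Sec m (Cov m →L[ℝ] V →L[ℝ] W)) :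
    Sec m V →ₗ[ℝ] Sec m W where
  toFun f := Sec.mk
    (fun x => a x (f x) + ∑ i, s x (dx i) (fderiv ℝ f.1 x (ebasis i)))
    ((a.smooth.clm_apply f.smooth).add (ContDiff.sum fun i _ =>
      (s.smooth.clm_apply contDiff_const).clm_apply (f.smooth_fderiv.clm_apply contDiff_const)))
  map_add' f g := by
    ext x
    simp only [Sec.mk_apply, Sec.add_apply, Sec.fderiv_add, map_add, _root_.add_apply,
      Finset.sum_add_distrib]
    abel
  map_smul' r f := by
    ext x
    simp only [Sec.mk_apply, Sec.smul_apply, Sec.fderiv_smul, map_smul, _root_.smul_apply,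
      ← Finset.smul_sum, ← smul_add, RingHom.id_apply]

theorem op_apply (a : Sec m (V →L[ℝ] W)) (s : Sec m (Cov m →L[ℝ] V →L[ℝ] W)) (f : Sec m V)
    (x : Eu m) :
    op a s f x = a x (f x) + ∑ i, s x (dx i) (fderiv ℝ f.1 x (ebasis i)) := rfl

theorem op_add (a a' : Sec m (V →L[ℝ] W)) (s s' : Sec m (Cov m →L[ℝ] V →L[ℝ] W)) :
    op (a + a') (s + s') = op a s + op a' s' := by
  ext f x
  simp only [LinearMap.add_apply, op_apply, Sec.add_apply, _root_.add_apply,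
    Finset.sum_add_distrib]
  abel

theorem op_smul (r : ℝ) (a : Sec m (V →L[ℝ] W)) (s : Sec m (Cov m →L[ℝ] V →L[ℝ] W)) :
    op (r • a) (r • s) = r • op a s := by
  ext f x
  simp only [LinearMap.smul_apply, op_apply, Sec.smul_apply, _root_.smul_apply, ← Finset.smul_sum,
    ← smul_add]

theorem op_zero : op (0 : Sec m (V →L[ℝ] W)) 0 = 0 := by
  ext f x
  simp [op_apply]

theorem op_inj {a a' : Sec m (V →L[ℝ] W)} {s s' : Sec m (Cov m →L[ℝ] V →L[ℝ] W)}
    (h : op a s = op a' s') : a = a' ∧ s = s' := by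
  have h1 : ∀ x v, a x v = a' x v := by
    intro x v
    have hd : fderiv ℝ (Sec.mk (fun _ : Eu m => v) contDiff_const).1 x = 0 :=
      (hasFDerivAt_const v x).fderiv
    have := congrArg (fun f : Sec m W => f x)
      (LinearMap.congr_fun h (Sec.mk (fun _ => v) contDiff_const))
    simp only [op_apply, hd] at this
    simpa using this
  have h2 : ∀ x i v, s x (dx i) v = s' x (dx i) v := by
    intro x i v
    have hd : fderiv ℝ (Sec.mk (fun y : Eu m => dx i y • v)
        ((dx i).contDiff.smul contDiff_const)).1 x = (dx i).smulRight v :=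
      ((dx i).hasFDerivAt.smul_const v).fderiv
    have := congrArg (fun f : Sec m W => f x)
      (LinearMap.congr_fun h (Sec.mk (fun y => dx i y • v) ((dx i).contDiff.smul contDiff_const)))
    simp only [op_apply, h1, hd, add_right_inj] at this
    simpa [Pi.single_apply, apply_ite] using this
  refine ⟨Sec.ext fun x => ContinuousLinearMap.ext (h1 x), Sec.ext fun x => ?_⟩
  ext η v
  rw [Cov.eq_sum η]
  simp only [map_sum, map_smul, _root_.sum_apply, _root_.smul_apply, h2]

variable [GlRep m V] [GlRep m W]

/-- The zeroth-order term produced by the second derivative of `X`. -/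
def opCorr (X : Vect m) (s : Sec m (Cov m →L[ℝ] V →L[ℝ] W)) : Sec m (V →L[ℝ] W) :=
  Sec.mk (fun x => ∑ i, (s x (dx i)).comp (GlRep.act (fderiv ℝ (fderiv ℝ X.1) x (ebasis i))))
    (ContDiff.sum fun i _ => (s.smooth.clm_apply contDiff_const).clm_comp
      ((GlRep.act (m := m) (V := V)).contDiff.comp
        ((X.smooth_fderiv.fderiv_right (by simp)).clm_apply contDiff_const)))

/-- The Lie derivative of a differential operator of order one. -/
theorem lie_op (X : Vect m) (a : Sec m (V →L[ℝ] W)) (s : Sec m (Cov m →L[ℝ] V →L[ℝ] W)) :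
    ⁅X, op a s⁆ = op (⁅X, a⁆ + opCorr X s) ⁅X, s⁆ := by
  ext f x
  rw [LieHom.lie_apply, Sec.sub_apply, Sec.lie_apply, op_apply, op_apply, op_apply]
  have hd : fderiv ℝ (op a s f).1 x (X x) = fderiv ℝ a.1 x (X x) (f x)
      + a x (fderiv ℝ f.1 x (X x))
      + ∑ i, (fderiv ℝ s.1 x (X x) (dx i) (fderiv ℝ f.1 x (ebasis i))
        + s x (dx i) (fderiv ℝ (fderiv ℝ f.1) x (X x) (ebasis i))) := by
    have h1 := (a.diff x).hasFDerivAt.clm_apply (f.diff x).hasFDerivAt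
    have h2 := fun i : Fin m => ((s.diff x).hasFDerivAt.clm_apply
      (hasFDerivAt_const (dx i) x)).clm_apply
      ((f.diff_fderiv x).hasFDerivAt.clm_apply (hasFDerivAt_const (ebasis i) x))
    have h3 := h1.add (HasFDerivAt.fun_sum (u := Finset.univ) fun i _ => h2 i)
    have h4 : fderiv ℝ (op a s f).1 x = _ := h3.fderiv
    rw [h4]
    simp [_root_.sum_apply, Finset.sum_add_distrib]
    abel
  have hl : ∀ i, fderiv ℝ (⁅X, f⁆ : Sec m V).1 x (ebasis i)
      = fderiv ℝ (fderiv ℝ f.1) x (X x) (ebasis i)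
      + fderiv ℝ f.1 x (fderiv ℝ X.1 x (ebasis i))
      - (GlRep.act (fderiv ℝ X.1 x) (fderiv ℝ f.1 x (ebasis i))
        + GlRep.act (fderiv ℝ (fderiv ℝ X.1) x (ebasis i)) (f x)) := by
    intro i
    rw [← f.fderiv_symm]
    exact fderiv_lieDer X f x (ebasis i)
  have ht := sum_transpose (LinearMap.mk₂ ℝ
    (fun (η : Cov m) (v : Eu m) => s x η (fderiv ℝ f.1 x v))
    (by intros; simp) (by intros; simp) (by intros; simp) (by intros; simp)) (fderiv ℝ X.1 x)
  simp only [LinearMap.mk₂_apply] at ht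
  rw [hd]
  simp only [hl, Sec.lie_apply, Sec.add_apply, opCorr, Sec.mk_apply, glRepHom_apply,
    _root_.sum_apply, _root_.sub_apply, _root_.add_apply, map_add, map_sub, map_sum,
    Finset.sum_add_distrib, Finset.sum_sub_distrib, ContinuousLinearMap.comp_apply, ht]
  have hc : ∀ i, s x (GlRep.act (fderiv ℝ X.1 x) (dx i)) (fderiv ℝ f.1 x (ebasis i))
      = - s x ((dx i).comp (fderiv ℝ X.1 x)) (fderiv ℝ f.1 x (ebasis i)) := by
    intro i
    have : GlRep.act (fderiv ℝ X.1 x) (dx i) = -((dx i).comp (fderiv ℝ X.1 x)) := rfl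
    rw [this, map_neg, _root_.neg_apply]
  simp only [hc, Finset.sum_neg_distrib]
  abel

variable (m V W)

/-- `𝒟⁰`: the differential operators of order zero from `C^∞(ℝ^m, V)` to `C^∞(ℝ^m, W)`,
`f ↦ a(f)`, with the action `L_X T = L_X ∘ T - T ∘ L_X` of `Vect(ℝ^m)`. -/
def DiffOp0 : LieSubmodule ℝ (Vect m) (Sec m V →ₗ[ℝ] Sec m W) where
  carrier := {T | ∃ a : Sec m (V →L[ℝ] W), T = op a 0}
  add_mem' := by
    rintro _ _ ⟨a, rfl⟩ ⟨a', rfl⟩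
    exact ⟨a + a', by rw [← op_add, add_zero]⟩
  zero_mem' := ⟨0, op_zero.symm⟩
  smul_mem' := by
    rintro r _ ⟨a, rfl⟩
    exact ⟨r • a, by rw [← op_smul, smul_zero]⟩
  lie_mem := by
    rintro X _ ⟨a, rfl⟩
    exact ⟨⁅X, a⁆ + opCorr X 0, by rw [lie_op, lie_zero]⟩

/-- `𝒟¹`: the differential operators of order at most one from `C^∞(ℝ^m, V)` to
`C^∞(ℝ^m, W)`, `f ↦ a(f) + ∑ i, sⁱ(∂_i f)` with `sⁱ = s(dx^i)`, with the action
`L_X T = L_X ∘ T - T ∘ L_X` of `Vect(ℝ^m)`. -/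
def DiffOp1 : LieSubmodule ℝ (Vect m) (Sec m V →ₗ[ℝ] Sec m W) where
  carrier := {T | ∃ (s : Sec m (Cov m →L[ℝ] V →L[ℝ] W)) (a : Sec m (V →L[ℝ] W)), T = op a s}
  add_mem' := by
    rintro _ _ ⟨s, a, rfl⟩ ⟨s', a', rfl⟩
    exact ⟨s + s', a + a', (op_add _ _ _ _).symm⟩
  zero_mem' := ⟨0, 0, op_zero.symm⟩
  smul_mem' := by
    rintro r _ ⟨s, a, rfl⟩
    exact ⟨r • s, r • a, (op_smul _ _ _).symm⟩
  lie_mem := by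
    rintro X _ ⟨s, a, rfl⟩
    exact ⟨⁅X, s⁆, ⁅X, a⁆ + opCorr X s, lie_op X a s⟩

/-- `𝒮¹`: the symbols of order one, i.e. `ℝ^m ⊗ Hom(V, W)`-valued tensor fields, viewed as smooth
families of `Hom(V, W)`-valued linear functions of `η ∈ ℝ^{m*}`. -/
abbrev Symb1 : Type := Sec m (Cov m →L[ℝ] V →L[ℝ] W)

variable {m V W}

/-- The coefficient `s` of an operator of order at most one is its principal symbol. -/
theorem exists_symbol (T : DiffOp1 m V W) :
    ∃! s : Symb1 m V W, ∃ a : Sec m (V →L[ℝ] W), T.1 = op a s := by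
  obtain ⟨s, a, h⟩ := T.2
  exact ⟨s, ⟨a, h⟩, fun s' ⟨a', h'⟩ => (op_inj (h'.symm.trans h)).2⟩

/-- The principal symbol, as a map. -/
def symbolFun (T : DiffOp1 m V W) : Symb1 m V W := (exists_symbol T).choose

theorem symbolFun_eq {T : DiffOp1 m V W} {s : Symb1 m V W} {a : Sec m (V →L[ℝ] W)}
    (h : T.1 = op a s) : symbolFun T = s :=
  ((exists_symbol T).choose_spec.2 s ⟨a, h⟩).symm

variable (g : LieSubalgebra ℝ (Vect m)) (V W)

/-- The inclusion `𝒟⁰ → 𝒟¹`, as a map of `g`-modules. -/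
def inclD : DiffOp0 m V W →ₗ⁅ℝ, g⁆ DiffOp1 m V W where
  toFun T := ⟨T.1, by obtain ⟨a, h⟩ := T.2; exact ⟨0, a, h⟩⟩
  map_add' _ _ := rfl
  map_smul' _ _ := rfl
  map_lie' := rfl

/-- The principal symbol `σ : 𝒟¹ → 𝒮¹`, as a map of `g`-modules. -/
def symbolD : DiffOp1 m V W →ₗ⁅ℝ, g⁆ Symb1 m V W where
  toFun := symbolFun
  map_add' T T' := by
    obtain ⟨s, a, h⟩ := T.2
    obtain ⟨s', a', h'⟩ := T'.2
    rw [symbolFun_eq h, symbolFun_eq h']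
    refine symbolFun_eq (a := a + a') ?_
    rw [op_add, ← h, ← h']
    rfl
  map_smul' r T := by
    obtain ⟨s, a, h⟩ := T.2
    rw [symbolFun_eq h]
    refine symbolFun_eq (a := r • a) ?_
    rw [RingHom.id_apply, op_smul, ← h]
    rfl
  map_lie' {X T} := by
    obtain ⟨s, a, h⟩ := T.2
    rw [symbolFun_eq h]
    refine symbolFun_eq (a := ⁅X.1, a⁆ + opCorr X.1 s) ?_
    change _ = op _ ⁅X.1, s⁆
    rw [← lie_op, ← h]
    rfl

variable {V W}

theorem symbolD_eq {T : DiffOp1 m V W} {s : Symb1 m V W} {a : Sec m (V →L[ℝ] W)}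
    (h : T.1 = op a s) : symbolD V W g T = s := symbolFun_eq h

variable (V W)

theorem inclD_injective : Function.Injective (inclD V W g) := fun _ _ h =>
  Subtype.ext (congrArg (fun T : DiffOp1 m V W => T.1) h)

theorem symbolD_surjective : Function.Surjective (symbolD V W g) := fun s =>
  ⟨⟨op 0 s, s, 0, rfl⟩, symbolD_eq g rfl⟩

theorem exact_inclD_symbolD : Function.Exact (inclD V W g) (symbolD V W g) := by
  intro T
  obtain ⟨s, a, h⟩ := T.2
  rw [symbolD_eq g h]
  constructor
  · rintro rfl
    exact ⟨⟨T.1, a, h⟩, rfl⟩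
  · rintro ⟨T', h'⟩
    obtain ⟨a', ha'⟩ := T'.2
    have h1 : T'.1 = T.1 := congrArg (fun T : DiffOp1 m V W => T.1) h'
    exact (op_inj (h.symm.trans (h1.symm.trans ha'))).2

/-- The connecting homomorphism `θ : Hⁿ(g, 𝒮¹) → Hⁿ⁺¹(g, 𝒟⁰)` of the short exact sequence
`0 → 𝒟⁰ → 𝒟¹ → 𝒮¹ → 0` of `g`-modules. -/
def θ (n : ℕ) : CE.H ℝ g (Symb1 m V W) n →ₗ[ℝ] CE.H ℝ g (DiffOp0 m V W) (n + 1) :=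
  CE.connecting (inclD_injective V W g) (symbolD_surjective V W g) (exact_inclD_symbolD V W g) n

variable {V W}

/-- The operator of order zero with a given coefficient: the identification of
`𝒮⁰ = C^∞(ℝ^m, Hom(V, W))` with `𝒟⁰`. -/
def mulOp : Sec m (V →L[ℝ] W) →ₗ[ℝ] DiffOp0 m V W where
  toFun a := ⟨op a 0, a, rfl⟩
  map_add' a a' := Subtype.ext (by simpa using op_add a a' 0 0)
  map_smul' r a := Subtype.ext (by simpa using op_smul r a 0)

theorem mulOp_apply (a : Sec m (V →L[ℝ] W)) (f : Sec m V) (x : Eu m) :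
    (mulOp a).1 f x = a x (f x) := by
  change op a 0 f x = _
  simp [op_apply]

end DiffOp

/-! ### The map `χ` -/

section Chi

variable {m : ℕ} {V : Type} [NormedAddCommGroup V] [NormedSpace ℝ V]

/-- The trace on `gl(m, ℝ)`. -/
def traceGl (m : ℕ) : Gl m →L[ℝ] ℝ :=
  LinearMap.toContinuousLinearMap
    ((LinearMap.trace ℝ (Eu m)).comp (ContinuousLinearMap.coeLM ℝ))

theorem traceGl_apply (A : Gl m) : traceGl m A = LinearMap.trace ℝ (Eu m) (A : Eu m →ₗ[ℝ] Eu m) :=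
  rfl

/-- The Jacobian `DX` of a vector field. -/
def jac : Vect m →ₗ[ℝ] Sec m (Gl m) where
  toFun X := Sec.mk (fderiv ℝ X.1) X.smooth_fderiv
  map_add' X Y := Sec.ext fun x => Sec.fderiv_add X Y x
  map_smul' r X := Sec.ext fun x => Sec.fderiv_smul r X x

theorem jac_apply (X : Vect m) (x : Eu m) : jac X x = fderiv ℝ X.1 x := rfl

/-- The differential `d tr(DX)` of the divergence of a vector field. -/
def dtr : Vect m →ₗ[ℝ] Sec m (Cov m) where
  toFun X := Sec.mk (fderiv ℝ fun x => traceGl m (jac X x))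
    (((traceGl m).contDiff.comp (jac X).smooth).fderiv_right (by simp))
  map_add' X Y := Sec.ext fun x => by
    have h : ∀ Z : Vect m, DifferentiableAt ℝ (fun x => traceGl m (jac Z x)) x := fun Z =>
      ((traceGl m).differentiableAt).comp x ((jac Z).diff x)
    have := _root_.fderiv_add (h X) (h Y)
    simp only [Sec.mk_apply, Sec.add_apply, map_add]
    exact this
  map_smul' r X := Sec.ext fun x => by
    have h : ∀ Z : Vect m, DifferentiableAt ℝ (fun x => traceGl m (jac Z x)) x := fun Z =>
      ((traceGl m).differentiableAt).comp x ((jac Z).diff x)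
    have := fderiv_const_smul (h X) r
    simp only [Sec.mk_apply, Sec.smul_apply, map_smul, RingHom.id_apply]
    exact this

theorem dtr_apply (X : Vect m) (x : Eu m) :
    dtr X x = fderiv ℝ (fun y => traceGl m (fderiv ℝ X.1 y)) x := rfl

variable {t u : ℕ}

theorem contDiff_alt_apply {E F : Type} [NormedAddCommGroup E] [NormedSpace ℝ E]
    [NormedAddCommGroup F] [NormedSpace ℝ F] {n : ℕ} {G : E → F [⋀^Fin n]→L[ℝ] V}
    (hG : ContDiff ℝ ∞ G) {v : Fin n → E → F} (hv : ∀ i, ContDiff ℝ ∞ (v i)) :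
    ContDiff ℝ ∞ (fun x => G x (fun i => v i x)) := by
  induction n with
  | zero =>
    have h := (ContinuousAlternatingMap.constOfIsEmptyLIE ℝ F V (Fin 0)).symm.contDiff.comp hG
    convert h using 1
    funext x
    change _ = G x _
    exact congrArg _ (Subsingleton.elim _ _)
  | succ n ih =>
    have h := ((ContinuousAlternatingMap.curryLeftLI
      (𝕜 := ℝ) (E := F) (F := V) (n := n)).toContinuousLinearMap.contDiff.comp hG).clm_apply (hv 0)
    convert ih h (v := fun i => v i.succ) fun i => hv i.succ using 1
    funext x
    change G x _ = G x _
    congr 1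
    funext i
    induction i using Fin.cases <;> rfl

theorem update_jac (X : Fin (t + u) → Vect m) (i : Fin t) (Y : Vect m) (x : Eu m) :
    (fun k => jac (Function.update X (Fin.castAdd u i) Y (Fin.castAdd u k)) x)
        = Function.update (fun k => jac (X (Fin.castAdd u k)) x) i (jac Y x)
      ∧ (fun k => dtr (Function.update X (Fin.castAdd u i) Y (Fin.natAdd t k)) x)
        = fun k => dtr (X (Fin.natAdd t k)) x := by
  constructor <;> funext k
  · rcases eq_or_ne k i with rfl | h
    · simp
    · rw [Function.update_of_ne (fun e => h (Fin.castAdd_injective _ _ e)),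
        Function.update_of_ne h]
  · rw [Function.update_of_ne]
    exact fun e => by
      have := congrArg Fin.val e
      simp at this
      omega

theorem update_dtr (X : Fin (t + u) → Vect m) (i : Fin u) (Y : Vect m) (x : Eu m) :
    (fun k => dtr (Function.update X (Fin.natAdd t i) Y (Fin.natAdd t k)) x)
        = Function.update (fun k => dtr (X (Fin.natAdd t k)) x) i (dtr Y x)
      ∧ (fun k => jac (Function.update X (Fin.natAdd t i) Y (Fin.castAdd u k)) x)
        = fun k => jac (X (Fin.castAdd u k)) x := by
  constructor <;> funext k
  · rcases eq_or_ne k i with rfl | h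
    · simp
    · rw [Function.update_of_ne (fun e => h (Fin.natAdd_injective _ _ e)),
        Function.update_of_ne h]
  · rw [Function.update_of_ne]
    exact fun e => by
      have := congrArg Fin.val e
      simp at this
      omega

/-- The multilinear map
`(X₀, …, X_{t+u-1}) ↦ c(DX₀, …, DX_{t-1})(d tr DX_t, …, d tr DX_{t+u-1})`. -/
def chiMul (c : Gl m [⋀^Fin t]→L[ℝ] (Cov m [⋀^Fin u]→L[ℝ] V)) :
    MultilinearMap ℝ (fun _ : Fin (t + u) => Vect m) (Sec m V) where
  toFun X := Sec.mk
    (fun x => c (fun i => jac (X (Fin.castAdd u i)) x) (fun j => dtr (X (Fin.natAdd t j)) x))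
    (contDiff_alt_apply (contDiff_alt_apply contDiff_const fun i => (jac _).smooth)
      fun j => (dtr _).smooth)
  map_update_add' := by
    intro inst X i Y Z
    obtain rfl : inst = instDecidableEqFin (t + u) := Subsingleton.elim _ _
    ext x
    induction i using Fin.addCases with
    | left i =>
      simp only [Sec.mk_apply, Sec.add_apply, (update_jac X i _ x).1, (update_jac X i _ x).2,
        map_add, ContinuousAlternatingMap.map_update_add, ContinuousAlternatingMap.add_apply]
    | right i =>
      simp only [Sec.mk_apply, Sec.add_apply, (update_dtr X i _ x).1, (update_dtr X i _ x).2,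
        map_add, ContinuousAlternatingMap.map_update_add]
  map_update_smul' := by
    intro inst X i r Y
    obtain rfl : inst = instDecidableEqFin (t + u) := Subsingleton.elim _ _
    ext x
    induction i using Fin.addCases with
    | left i =>
      simp only [Sec.mk_apply, Sec.smul_apply, (update_jac X i _ x).1, (update_jac X i _ x).2,
        map_smul, ContinuousAlternatingMap.map_update_smul, ContinuousAlternatingMap.smul_apply]
    | right i =>
      simp only [Sec.mk_apply, Sec.smul_apply, (update_dtr X i _ x).1, (update_dtr X i _ x).2,
        map_smul, ContinuousAlternatingMap.map_update_smul]

/-- The map `χ : ∧^t(gl(m, ℝ), ∧^u(ℝ^{m*}, V)) → ∧^{t+u}(sl_{m+1}, C^∞(ℝ^m, V))`,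
`χ(c)(X₀, …, X_{t+u-1}) = (-1)^t / (t! u! (m+1)^u) *
  ∑ ν, sign(ν) c(DX_{ν 0}, …, DX_{ν(t-1)})(d tr DX_{ν t}, …, d tr DX_{ν(t+u-1)})`. -/
def χ (c : Gl m [⋀^Fin t]→L[ℝ] (Cov m [⋀^Fin u]→L[ℝ] V)) :
    slProj m [⋀^Fin (t + u)]→ₗ[ℝ] Sec m V :=
  ((-1 : ℝ) ^ t / (t.factorial * u.factorial * ((m : ℝ) + 1) ^ u)) •
    (MultilinearMap.alternatization (chiMul c)).compLinearMap (slProj m).toSubmodule.subtype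

theorem χ_apply (c : Gl m [⋀^Fin t]→L[ℝ] (Cov m [⋀^Fin u]→L[ℝ] V)) (X : Fin (t + u) → slProj m)
    (x : Eu m) :
    χ c X x = ((-1 : ℝ) ^ t / (t.factorial * u.factorial * ((m : ℝ) + 1) ^ u)) •
      ∑ ν : Equiv.Perm (Fin (t + u)), (Equiv.Perm.sign ν : ℤ) •
        c (fun i => fderiv ℝ (X (ν (Fin.castAdd u i))).1.1 x)
          (fun j => fderiv ℝ (fun y => traceGl m (fderiv ℝ (X (ν (Fin.natAdd t j))).1.1 y)) x) := by
  rw [χ, AlternatingMap.smul_apply, Sec.smul_apply, AlternatingMap.compLinearMap_apply,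
    MultilinearMap.alternatization_apply]
  congr 1
  have h : ∀ (s : Finset (Equiv.Perm (Fin (t + u)))) (F : Equiv.Perm (Fin (t + u)) → Sec m V),
      (∑ ν ∈ s, F ν) x = ∑ ν ∈ s, F ν x := by
    intro s F
    induction s using Finset.cons_induction with
    | empty => rfl
    | cons a s ha ih => rw [Finset.sum_cons, Finset.sum_cons, Sec.add_apply, ih]
  rw [h]
  refine Finset.sum_congr rfl fun ν _ => ?_
  rcases Int.units_eq_one_or (Equiv.Perm.sign ν) with hν | hν
  · rw [hν, one_smul, Units.val_one, one_smul]
    rfl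
  · rw [hν, Units.neg_smul, one_smul, Units.val_neg, Units.val_one, neg_smul, one_smul]
    rfl

end Chi

/-! ### Invariants and the contractions `I₀`, `I₁` -/

section Invariants

variable (m a : ℕ)

/-- The space `(∧^a gl(m, ℝ)^*)_{g-inv}` of alternating forms on `gl(m, ℝ)` invariant under the
adjoint action. -/
def glInv : Submodule ℝ (Gl m [⋀^Fin a]→L[ℝ] ℝ) where
  carrier := {γ | ∀ (A : Gl m) (B : Fin a → Gl m),
    ∑ i, γ (Function.update B i (A * B i - B i * A)) = 0}
  add_mem' {γ γ'} h h' A B := by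
    simp only [ContinuousAlternatingMap.add_apply, Finset.sum_add_distrib, h A B, h' A B, add_zero]
  zero_mem' A B := by simp
  smul_mem' r γ h A B := by
    simp only [ContinuousAlternatingMap.smul_apply, ← Finset.smul_sum, h A B, smul_zero]

variable {m}

/-- The contraction `i_α : ∧^{p+1} ℝ^m → ∧^p ℝ^m`, `(i_α T)(β₁, …, β_p) = T(α, β₁, …, β_p)`,
as a function of `α`. -/
def contr (p : ℕ) : Cov m →L[ℝ] Lam m (p + 1) →L[ℝ] Lam m p :=
  (ContinuousAlternatingMap.curryLeftLI
    (𝕜 := ℝ) (E := Cov m) (F := ℝ) (n := p)).toContinuousLinearMap.flip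

theorem contr_apply {p : ℕ} (α : Cov m) (T : Lam m (p + 1)) (β : Fin p → Cov m) :
    contr p α T β = T (Matrix.vecCons α β) := rfl

/-- The iterated contraction `i_{α₁} ⋯ i_{α_n} : ∧^{q+n} ℝ^m → ∧^q ℝ^m`. -/
def contrIter (q : ℕ) : (n : ℕ) → (Fin n → Cov m) → (Lam m (q + n) →L[ℝ] Lam m q)
  | 0, _ => ContinuousLinearMap.id ℝ _
  | n + 1, α => (contrIter q n (Fin.init α)).comp (contr (q + n) (α (Fin.last n)))

theorem contrIter_succ (q n : ℕ) (α : Fin (n + 1) → Cov m) :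
    contrIter q (n + 1) α
      = (contrIter q n (Fin.init α)).comp (contr (q + n) (α (Fin.last n))) := rfl

theorem contr_contr_self {p : ℕ} (α : Cov m) (T : Lam m (p + 2)) :
    contr p α (contr (p + 1) α T) = 0 :=
  ContinuousAlternatingMap.curryLeft_same T α

theorem contr_contr {p : ℕ} (α β : Cov m) (T : Lam m (p + 2)) :
    contr p α (contr (p + 1) β T) = - contr p β (contr (p + 1) α T) := by
  have h := contr_contr_self (α + β) T
  simp only [map_add, _root_.add_apply, contr_contr_self, zero_add, add_zero] at h
  exact eq_neg_of_add_eq_zero_left (by rw [← h]; abel)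

theorem contrIter_contr (q n : ℕ) (α : Fin n → Cov m) (i : Fin n) (T : Lam m (q + n + 1)) :
    contrIter q n α (contr (q + n) (α i) T) = 0 := by
  induction n with
  | zero => exact i.elim0
  | succ n ih =>
    rw [contrIter_succ, ContinuousLinearMap.comp_apply]
    induction i using Fin.lastCases with
    | last =>
      have := contr_contr_self (p := q + n) (α (Fin.last n)) T
      exact (congrArg _ this).trans (map_zero _)
    | cast i =>
      have h1 := contr_contr (p := q + n) (α (Fin.last n)) (α i.castSucc) T
      refine (congrArg _ h1).trans ?_
      rw [map_neg, neg_eq_zero]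
      exact ih (Fin.init α) i _

/-- `I₀ ∈ ∧^n(ℝ^{m*}, Hom(∧^{q+n} ℝ^m, ∧^q ℝ^m))`,
`I₀(α₁, …, α_n)(T) = i_{α₁} ⋯ i_{α_n} T`. -/
def I₀ (q n : ℕ) : Cov m [⋀^Fin n]→L[ℝ] (Lam m (q + n) →L[ℝ] Lam m q) where
  toFun := contrIter q n
  map_update_add' := by
    intro inst α i x y
    obtain rfl : inst = instDecidableEqFin n := Subsingleton.elim _ _
    induction n with
    | zero => exact i.elim0
    | succ n ih =>
      simp only [contrIter_succ]
      induction i using Fin.lastCases with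
      | last => simp [Fin.init_update_last]
      | cast i => simp [Fin.init_update_castSucc, ih, (Fin.castSucc_lt_last i).ne']
  map_update_smul' := by
    intro inst α i r x
    obtain rfl : inst = instDecidableEqFin n := Subsingleton.elim _ _
    induction n with
    | zero => exact i.elim0
    | succ n ih =>
      simp only [contrIter_succ]
      induction i using Fin.lastCases with
      | last => simp [Fin.init_update_last]
      | cast i => simp [Fin.init_update_castSucc, ih, (Fin.castSucc_lt_last i).ne']
  map_eq_zero_of_eq' := by
    intro α i j h hij
    change contrIter q n α = 0
    induction n with
    | zero => exact i.elim0
    | succ n ih =>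
      rw [contrIter_succ]
      induction i using Fin.lastCases with
      | last =>
        induction j using Fin.lastCases with
        | last => exact absurd rfl hij
        | cast j =>
          ext1 T
          rw [h]
          exact contrIter_contr q n (Fin.init α) j T
      | cast i =>
        induction j using Fin.lastCases with
        | last =>
          ext1 T
          rw [← h]
          exact contrIter_contr q n (Fin.init α) i T
        | cast j =>
          rw [ih (Fin.init α) i j h (fun e => hij (by rw [e])), ContinuousLinearMap.zero_comp]
  cont := by
    change Continuous (contrIter q n)
    induction n with
    | zero => exact continuous_const
    | succ n ih =>
      refine Continuous.clm_comp (ih.comp ?_) ((contr (q + n)).continuous.comp (continuous_apply _))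
      exact continuous_pi fun i => continuous_apply _

theorem I₀_apply (q n : ℕ) (α : Fin n → Cov m) : I₀ q n α = contrIter q n α := rfl

/-- `I₁ ∈ ∧^r(ℝ^{m*}, ℝ^m ⊗ Hom(∧^{q+r+1} ℝ^m, ∧^q ℝ^m))`,
`I₁(α₁, …, α_r)(η)(T) = i_η i_{α₁} ⋯ i_{α_r} T`. -/
def I₁ (q r : ℕ) : Cov m [⋀^Fin r]→L[ℝ] (Cov m →L[ℝ] Lam m (q + (r + 1)) →L[ℝ] Lam m q) :=
  ((I₀ q (r + 1)).curryLeft).flipAlternating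

theorem I₁_apply (q r : ℕ) (α : Fin r → Cov m) (η : Cov m) :
    I₁ q r α η = contrIter q (r + 1) (Matrix.vecCons η α) := rfl

end Invariants

end

/-! The connecting map can be computed with any linear lift of symbols, and the convenient one sends
`s` to the operator `op 0 s` without zeroth-order term. By `lie_op` this lift fails to be
equivariant only by the zeroth-order operator `opCorr X s`, which contracts `s` with the second
derivative of `X`. So for a cocycle `c` the class θ[c] is represented by ∑ (-1)^i opCorr Xᵢ (c(…,
X̂ᵢ, …)); see `d_liftOp` and `θ_cls`.

For X in sl_{m+1} the second derivative is e ↦ α ⊗ e + α(e) id with a constant covector α, and d tr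
DX = (m+1)α. On skew tensors, ∑ i_{dx^i} ρ(α ⊗ eᵢ + α(eᵢ) id) = (m+1) i_α (`sum_contr_act`), which
is exactly the contraction with d tr DX. The correction of I₁(β) is therefore I₀(d tr DX, β)
(`opCorrAt_I₁`): the argument that was left out reappears as a new covector. The alternating sum
over i rebuilds the sum over permutations that defines χ(γ ⊗ I₀), and only the constants remain to
be compared (`sum_opCorr_chi`), with r = p - q - 1. Moving the new argument past the a arguments of
γ gives (-1)^a, the passage from r! to (r+1)! gives r + 1 = p - q, and the passage from (m+1)^r to
(m+1)^(r+1) gives m + 1.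

That χ(γ ⊗ I₁) is a cocycle comes from a symmetry. Invariance of γ and equivariance of I₁ cancel
everything in the coboundary except terms symmetric in two of the vector fields, and alternation
kills these (`two_smul_lie_chiMul`, `chi_smulRight_mem_cocycles`). For χ(γ ⊗ I₀) the cocycle
property is then automatic, since a nonzero multiple of it is a connecting cochain. -/

section SignedSums

/-! ### Signed sums over permutations. -/

variable {L M : Type*} [AddCommGroup M]

/-- Expansion of a signed sum over permutations along the image of the first index. -/
theorem sum_sign_perm_succ {n : ℕ} (f : (Fin (n + 1) → L) → M) (x : Fin (n + 1) → L) :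
    ∑ ν : Equiv.Perm (Fin (n + 1)), (Equiv.Perm.sign ν : ℤ) • f (fun k => x (ν k))
      = ∑ i : Fin (n + 1), (-1 : ℤ) ^ (i : ℕ) • ∑ σ : Equiv.Perm (Fin n),
          (Equiv.Perm.sign σ : ℤ) • f (Fin.cons (x i) (fun k => i.removeNth x (σ k))) := by
  -- The permutation attached to (i, σ) sends 0 to i and enumerates the other indices in the order
  -- given by σ. Its sign is (-1)^i sign σ; injectivity suffices because (n+1) · n! = (n+1)!.
  let e : Fin (n + 1) × Equiv.Perm (Fin n) → Equiv.Perm (Fin (n + 1)) := fun p =>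
    p.1.cycleRange.symm * Equiv.Perm.decomposeFin.symm (0, p.2)
  have e0 : ∀ p, e p 0 = p.1 := fun p => by
    simp [e, Equiv.Perm.mul_apply, Equiv.Perm.decomposeFin_symm_apply_zero]
  have es : ∀ p (k : Fin n), e p k.succ = p.1.succAbove (p.2 k) := fun p k => by
    simp [e, Equiv.Perm.mul_apply, Equiv.Perm.decomposeFin_symm_apply_succ]
  have he : Function.Bijective e := by
    refine (Fintype.bijective_iff_injective_and_card e).2 ⟨?_, ?_⟩
    · rintro ⟨i, σ⟩ ⟨j, τ⟩ h
      obtain rfl : i = j := by exact (e0 (i, σ)).symm.trans ((congrArg (· 0) h).trans (e0 _))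
      refine Prod.ext rfl (Equiv.ext fun k => ?_)
      refine Fin.succAbove_right_injective (p := i) ?_
      rw [← es (i, σ), h, es]
    · simp [Fintype.card_perm, Nat.factorial_succ]
  rw [← he.sum_comp, Fintype.sum_prod_type]
  refine Finset.sum_congr rfl fun i _ => ?_
  rw [Finset.smul_sum]
  refine Finset.sum_congr rfl fun σ _ => ?_
  rw [smul_smul]
  congr 1
  · simp [e, Equiv.Perm.decomposeFin.symm_sign, Fin.sign_cycleRange, Equiv.Perm.sign_symm]
  · congr 1
    funext k
    induction k using Fin.cases with
    | zero => simp only [e0, Fin.cons_zero]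
    | succ k => simp only [es, Fin.cons_succ, Fin.removeNth_apply]

/-- Right multiplication by the transposition is a fixed-point-free involution that keeps the value
of `f` and reverses the sign, so the terms cancel in pairs. -/
theorem sum_sign_perm_eq_zero {n : ℕ} (f : (Fin n → L) → M) {i j : Fin n} (hij : i ≠ j)
    (hf : ∀ y, f (fun k => y (Equiv.swap i j k)) = f y) (x : Fin n → L) :
    ∑ ν : Equiv.Perm (Fin n), (Equiv.Perm.sign ν : ℤ) • f (fun k => x (ν k)) = 0 := by
  refine Finset.sum_involution (fun ν _ => ν * Equiv.swap i j) (fun ν _ => ?_) (fun ν _ _ h => ?_)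
    (fun _ _ => Finset.mem_univ _) (fun ν _ => by simp [mul_assoc])
  · have h := hf (fun k => x (ν k))
    simp only [Equiv.Perm.mul_apply, h, Equiv.Perm.sign_mul, Equiv.Perm.sign_swap hij]
    simp
  · exact hij (Equiv.swap_eq_one_iff.1 (mul_eq_left.1 h))

end SignedSums

/-! ### The coboundary of an alternatization. -/

namespace CE

section Alternatization

variable {K L M : Type*} [Field K] [LieRing L] [LieAlgebra K L]
  [AddCommGroup M] [Module K M] [LieRingModule L M] [LieModule K L M]

theorem neg_one_pow_smul_int (k : ℕ) (v : M) : (-1 : K) ^ k • v = (-1 : ℤ) ^ k • v := by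
  rcases neg_one_pow_eq_or K k with h | h <;> rcases Nat.even_or_odd k with hk | hk <;>
    simp [hk.neg_one_pow]

/-- A symmetrized form of the coboundary, in which both kinds of arguments of a bracket are
treated alike. -/
theorem two_smul_d_apply {n : ℕ} (c : L [⋀^Fin n]→ₗ[K] M) (x : Fin (n + 1) → L) :
    (2 : ℤ) • d n c x = ∑ i : Fin (n + 1), (-1 : ℤ) ^ (i : ℕ) •
      ((2 : ℤ) • ⁅x i, c (i.removeNth x)⁆
        - ∑ j, c (Function.update (i.removeNth x) j ⁅x i, i.removeNth x j⁆)) := by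
  let g : Fin (n + 1) → Fin (n + 1) → M := fun i j =>
    (-1 : ℤ) ^ (i : ℕ) • c (i.removeNth (Function.update x j ⁅x i, x j⁆))
  -- Put the bracket ⁅xᵢ, xⱼ⁆ in both places i and j. For an alternating map, deleting one or the
  -- other of two equal entries gives values related by the sign -(-1)^(i+j). This minus sign is
  -- absorbed by ⁅xᵢ, xⱼ⁆ = -⁅xⱼ, xᵢ⁆. Hence the sum over j < i equals the one over j > i, which
  -- explains the factor 2.
  have hg : ∀ i j, i ≠ j → g i j = g j i := by
    intro i j hij
    have h := c.neg_one_pow_smul_map_removeNth_add_eq_zero_of_eq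
      (v := Function.update (Function.update x i ⁅x i, x j⁆) j ⁅x i, x j⁆) (i := i) (j := j)
      (by simp [hij]) hij
    rw [Fin.removeNth_update, Function.update_comm hij, Fin.removeNth_update] at h
    refine (eq_neg_of_add_eq_zero_left h).trans ?_
    obtain ⟨k, rfl⟩ := Fin.exists_succAbove_eq hij
    simp only [g, Fin.removeNth_update_succAbove]
    rw [← lie_skew (x j), AlternatingMap.map_update_neg, smul_neg]
  have h1 : ∀ i, ∑ j, c (Function.update (i.removeNth x) j ⁅x i, i.removeNth x j⁆)
      = ∑ j ∈ Finset.Ioi i, c (i.removeNth (Function.update x j ⁅x i, x j⁆))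
        + ∑ j ∈ Finset.Iio i, c (i.removeNth (Function.update x j ⁅x i, x j⁆)) := by
    intro i
    rw [← Finset.sum_union (Finset.disjoint_left.2 fun j h h' =>
      lt_asymm (Finset.mem_Ioi.1 h) (Finset.mem_Iio.1 h'))]
    have hu : Finset.Ioi i ∪ Finset.Iio i = Finset.univ.map i.succAboveEmb := by
      ext j
      simp [Fin.exists_succAbove_eq_iff, lt_or_lt_iff_ne, ne_comm]
    rw [hu, Finset.sum_map]
    exact Finset.sum_congr rfl fun j _ => by
      simp only [Fin.coe_succAboveEmb, Fin.removeNth_update_succAbove, Fin.removeNth_apply]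
  have h2 : ∑ i, ∑ j ∈ Finset.Iio i, g i j = ∑ i, ∑ j ∈ Finset.Ioi i, g i j := by
    rw [Finset.sum_comm' (t' := Finset.univ) (s' := fun j => Finset.Ioi j) (by simp)]
    exact Finset.sum_congr rfl fun j _ => Finset.sum_congr rfl fun i hi =>
      hg i j (Finset.mem_Ioi.1 hi).ne'
  simp only [d_apply, neg_one_pow_smul_int, h1, smul_sub, smul_add, Finset.sum_sub_distrib,
    Finset.sum_add_distrib, Finset.smul_sum (s := Finset.Ioi _), Finset.smul_sum (s := Finset.Iio _)]
  change _ = _ - (∑ i, ∑ j ∈ Finset.Ioi i, g i j + ∑ i, ∑ j ∈ Finset.Iio i, g i j)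
  rw [h2, ← two_zsmul, Finset.smul_sum]
  simp only [smul_comm (2 : ℤ)]
  rfl

/-- The coboundary of the alternatization of a multilinear map. -/
theorem two_smul_d_alternatization {n : ℕ} (μ : MultilinearMap K (fun _ : Fin n => L) M)
    (x : Fin (n + 1) → L) :
    (2 : ℤ) • d n (MultilinearMap.alternatization μ) x
      = ∑ ν : Equiv.Perm (Fin (n + 1)), (Equiv.Perm.sign ν : ℤ) •
        (fun y : Fin (n + 1) → L => (2 : ℤ) • ⁅y 0, μ (Fin.tail y)⁆
          - ∑ j, μ (Function.update (Fin.tail y) j ⁅y 0, y j.succ⁆)) (fun k => x (ν k)) := by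
  rw [two_smul_d_apply]
  refine Eq.trans ?_ (sum_sign_perm_succ (fun y : Fin (n + 1) → L => (2 : ℤ) • ⁅y 0, μ (Fin.tail y)⁆
    - ∑ j, μ (Function.update (Fin.tail y) j ⁅y 0, y j.succ⁆)) x).symm
  refine Finset.sum_congr rfl fun i _ => congrArg _ ?_
  have h : ∀ y : Fin n → L, MultilinearMap.alternatization μ y
      = ∑ σ : Equiv.Perm (Fin n), (Equiv.Perm.sign σ : ℤ) • μ (fun k => y (σ k)) := fun y => by
    rw [MultilinearMap.alternatization_apply]
    rfl
  simp only [h, lie_sum, lie_zsmul, Fin.cons_zero, Fin.tail_cons, Fin.cons_succ]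
  rw [Finset.sum_comm, Finset.smul_sum, ← Finset.sum_sub_distrib]
  refine Finset.sum_congr rfl fun σ _ => ?_
  rw [smul_sub, smul_comm, ← Finset.smul_sum]
  congr 2
  -- The slot that receives the bracket is relabelled by σ, so that updating and permuting commute.
  rw [← Equiv.sum_comp σ]
  refine Finset.sum_congr rfl fun j _ => congrArg μ ?_
  exact Function.update_comp_eq_of_injective _ σ.injective _ _

/-- A criterion for an alternatization to be closed: before alternation, the coboundary should split
into terms `G j`, each unchanged when the differentiating argument 0 is exchanged with argument j +
1. The map `e` allows this to be tested after evaluation at a point. -/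
theorem map_d_alternatization_eq_zero [CharZero K] {N : Type*} [AddCommGroup N] [Module K N]
    (e : M →ₗ[K] N) {n : ℕ} (μ : MultilinearMap K (fun _ : Fin n => L) M)
    (G : Fin n → (Fin (n + 1) → L) → N)
    (hμ : ∀ y : Fin (n + 1) → L, e ((2 : ℤ) • ⁅y 0, μ (Fin.tail y)⁆
      - ∑ j, μ (Function.update (Fin.tail y) j ⁅y 0, y j.succ⁆)) = ∑ j, G j y)
    (hG : ∀ j y, G j (fun k => y (Equiv.swap 0 j.succ k)) = G j y) (x : Fin (n + 1) → L) :
    e (d n (MultilinearMap.alternatization μ) x) = 0 := by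
  have h := congrArg e (two_smul_d_alternatization μ x)
  rw [map_sum] at h
  replace h := h.trans (Finset.sum_congr rfl fun ν _ =>
    (map_zsmul e _ _).trans (congrArg _ (hμ fun k => x (ν k))))
  simp only [Finset.smul_sum] at h
  rw [Finset.sum_comm, Finset.sum_eq_zero fun j _ =>
    sum_sign_perm_eq_zero (G j) (Fin.succ_ne_zero j).symm (hG j) x, map_zsmul,
    ← Int.cast_smul_eq_zsmul K] at h
  exact (smul_eq_zero.1 h).resolve_left (by simp)

end Alternatization

end CE

/-! ### Invariant forms and equivariant maps give cocycles. -/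

section ChiCocycle

variable {m : ℕ} {V : Type} [NormedAddCommGroup V] [NormedSpace ℝ V]

/-- Evaluation of sections at a point. -/
noncomputable def Sec.eval (x : Eu m) : Sec m V →ₗ[ℝ] V where
  toFun f := f x
  map_add' _ _ := rfl
  map_smul' _ _ := rfl

theorem Sec.eval_apply (x : Eu m) (f : Sec m V) : Sec.eval x f = f x := rfl

theorem traceGl_mul_comm (A B : Gl m) : traceGl m (A * B) = traceGl m (B * A) :=
  LinearMap.trace_mul_comm ℝ (A : Eu m →ₗ[ℝ] Eu m) (B : Eu m →ₗ[ℝ] Eu m)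

/-- The divergence of a vector field. -/
noncomputable def divergence (X : Vect m) : Sec m ℝ :=
  Sec.mk (fun x => traceGl m (fderiv ℝ X.1 x)) ((traceGl m).contDiff.comp X.smooth_fderiv)

theorem fderiv_divergence (X : Vect m) (x : Eu m) : fderiv ℝ (divergence X).1 x = dtr X x := rfl

theorem dtr_apply_eq_traceGl (X : Vect m) (x v : Eu m) :
    dtr X x v = traceGl m (fderiv ℝ (fderiv ℝ X.1) x v) := by
  have h := (traceGl m).hasFDerivAt.comp x (X.diff_fderiv x).hasFDerivAt
  exact congrArg (fun A : Cov m => A v) h.fderiv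

/-- The Jacobian of a bracket contains the commutator of the Jacobians, which has trace zero; only
the second-derivative terms survive. -/
theorem divergence_lie (X Y : Vect m) (x : Eu m) :
    divergence ⁅X, Y⁆ x = dtr Y x (X x) - dtr X x (Y x) := by
  change traceGl m (fderiv ℝ (⁅X, Y⁆ : Vect m).1 x) = _
  rw [Vect.fderiv_lie, map_sub, map_sub, map_sub, traceGl_mul_comm, sub_self, sub_zero,
    dtr_apply_eq_traceGl, dtr_apply_eq_traceGl]

/-- The map `X ↦ d tr DX` is a `1`-cocycle. -/
theorem dtr_lie (X Y : Vect m) : dtr ⁅X, Y⁆ = ⁅X, dtr Y⁆ - ⁅Y, dtr X⁆ := by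
  ext x v
  have h1 : fderiv ℝ (divergence ⁅X, Y⁆).1 x
      = fderiv ℝ (fun y => dtr Y y (X y) - dtr X y (Y y)) x :=
    congrArg (fun f => fderiv ℝ f x) (funext (divergence_lie X Y))
  have h2 := (((dtr Y).diff x).hasFDerivAt.clm_apply (X.diff x).hasFDerivAt).sub
    (((dtr X).diff x).hasFDerivAt.clm_apply (Y.diff x).hasFDerivAt)
  have h3 : fderiv ℝ (fun y => dtr Y y (X y) - dtr X y (Y y)) x = _ := h2.fderiv
  -- Since `dtr Z` is the differential of a function, its derivative is a Hessian. This symmetry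
  -- turns the derivative in direction v into the derivative along the vector field required by the
  -- Lie derivative.
  have hs : ∀ (Z : Vect m) (w : Eu m), fderiv ℝ (dtr Z).1 x v w = fderiv ℝ (dtr Z).1 x w v :=
    fun Z w => (divergence Z).fderiv_symm x v w
  rw [← fderiv_divergence, h1, h3]
  simp only [Sec.sub_apply, Sec.lie_apply, _root_.sub_apply, _root_.add_apply,
    ContinuousLinearMap.comp_apply, ContinuousLinearMap.flip_apply, glRepCov_apply, hs]
  abel

theorem Vect.jac_lie (X Y : Vect m) (x : Eu m) :
    jac ⁅X, Y⁆ x = fderiv ℝ (jac Y).1 x (X x) - fderiv ℝ (jac X).1 x (Y x)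
      - (jac X x * jac Y x - jac Y x * jac X x) :=
  Vect.fderiv_lie X Y x

variable [GlRep m V] {t u : ℕ}

theorem chiMul_smulRight_apply (γ : Gl m [⋀^Fin t]→L[ℝ] ℝ) (I : Cov m [⋀^Fin u]→L[ℝ] V)
    (X : Fin (t + u) → Vect m) (x : Eu m) :
    chiMul (γ.smulRight I) X x = γ (fun i => jac (X (Fin.castAdd u i)) x)
      • I (fun j => dtr (X (Fin.natAdd t j)) x) := rfl

set_option maxHeartbeats 1000000 in
-- Leibniz rule: γ and I have constant coefficients, so only their arguments are differentiated.
theorem fderiv_chiMul_smulRight (γ : Gl m [⋀^Fin t]→L[ℝ] ℝ) (I : Cov m [⋀^Fin u]→L[ℝ] V)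
    (X : Fin (t + u) → Vect m) (x v : Eu m) :
    fderiv ℝ (chiMul (γ.smulRight I) X).1 x v
      = (∑ i, γ (Function.update (fun i => jac (X (Fin.castAdd u i)) x) i
            (fderiv ℝ (jac (X (Fin.castAdd u i))).1 x v)))
          • I (fun j => dtr (X (Fin.natAdd t j)) x)
        + γ (fun i => jac (X (Fin.castAdd u i)) x)
          • ∑ j, I (Function.update (fun j => dtr (X (Fin.natAdd t j)) x) j
            (fderiv ℝ (dtr (X (Fin.natAdd t j))).1 x v)) := by
  have h1 := (hasFDerivAt_const γ x).continuousAlternatingMap_apply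
    fun i => ((jac (X (Fin.castAdd u i))).diff x).hasFDerivAt
  have h2 := (hasFDerivAt_const I x).continuousAlternatingMap_apply
    fun j => ((dtr (X (Fin.natAdd t j))).diff x).hasFDerivAt
  have h3 : fderiv ℝ (chiMul (γ.smulRight I) X).1 x = _ := (h1.smul h2).fderiv
  rw [h3]
  simp [_root_.sum_apply, add_comm]

/-- Equivariance of an alternating map on `ℝ^{m*}` with values in a representation. -/
def IsGlEquivariant (I : Cov m [⋀^Fin u]→L[ℝ] V) : Prop :=
  ∀ (A : Gl m) (α : Fin u → Cov m),
    GlRep.act A (I α) = ∑ j, I (Function.update α j (GlRep.act A (α j)))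

/-- Restricting to sl_{m+1} before alternating brings χ into the form required by
`CE.map_d_alternatization_eq_zero`. -/
theorem chi_eq_smul_alternatization (c : Gl m [⋀^Fin t]→L[ℝ] (Cov m [⋀^Fin u]→L[ℝ] V)) :
    χ c = ((-1 : ℝ) ^ t / (t.factorial * u.factorial * ((m : ℝ) + 1) ^ u)) •
      MultilinearMap.alternatization
        ((chiMul c).compLinearMap fun _ => (slProj m).toSubmodule.subtype) := by
  rw [χ]
  congr 1
  ext X
  rw [AlternatingMap.compLinearMap_apply, MultilinearMap.alternatization_apply,
    MultilinearMap.alternatization_apply]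
  rfl

/-- Equivariance of I distributes ρ(DY) over the covectors, so L_Y acts on them by Lie derivatives
and on the Jacobians by plain derivatives. The brackets inside the arguments contribute the same
terms minus those with Y and X_k exchanged, by `Vect.jac_lie` and `dtr_lie`, up to commutators that
invariance of γ removes. Twice the former minus the latter is a sum of expressions symmetric in Y
and X_k. The identity holds for all vector fields, projective or not. -/
theorem two_smul_lie_chiMul {γ : Gl m [⋀^Fin t]→L[ℝ] ℝ} (hγ : γ ∈ glInv m t)
    {I : Cov m [⋀^Fin u]→L[ℝ] V} (hI : IsGlEquivariant I) (Y : Vect m) (X : Fin (t + u) → Vect m)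
    (x : Eu m) :
    ((2 : ℤ) • ⁅Y, chiMul (γ.smulRight I) X⁆ : Sec m V) x
        - ∑ k, chiMul (γ.smulRight I) (Function.update X k ⁅Y, X k⁆) x
      = (∑ i, γ (Function.update (fun i => jac (X (Fin.castAdd u i)) x) i
            (fderiv ℝ (jac (X (Fin.castAdd u i))).1 x (Y x)
              + fderiv ℝ (jac Y).1 x (X (Fin.castAdd u i) x))))
          • I (fun j => dtr (X (Fin.natAdd t j)) x)
        + γ (fun i => jac (X (Fin.castAdd u i)) x)
          • ∑ j, I (Function.update (fun j => dtr (X (Fin.natAdd t j)) x) j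
            (⁅Y, dtr (X (Fin.natAdd t j))⁆ x + ⁅X (Fin.natAdd t j), dtr Y⁆ x)) := by
  have h0 : ((2 : ℤ) • ⁅Y, chiMul (γ.smulRight I) X⁆ : Sec m V) x
      = (2 : ℝ) • (⁅Y, chiMul (γ.smulRight I) X⁆ : Sec m V) x := by
    rw [← Int.cast_smul_eq_zsmul ℝ, Sec.smul_apply]; norm_num
  have hγ' := hγ (jac Y x) fun i => jac (X (Fin.castAdd u i)) x
  rw [h0, Sec.lie_apply, fderiv_chiMul_smulRight, Fin.sum_univ_add, chiMul_smulRight_apply,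
    map_smul, hI]
  simp only [chiMul_smulRight_apply, (update_jac X _ _ x).1, (update_jac X _ _ x).2,
    (update_dtr X _ _ x).1, (update_dtr X _ _ x).2, Vect.jac_lie, dtr_lie, Sec.sub_apply,
    Sec.lie_apply (V := Cov m),
    ContinuousAlternatingMap.map_update_sub, ContinuousAlternatingMap.map_update_add,
    Finset.sum_sub_distrib, Finset.sum_add_distrib, sub_smul, add_smul,
    ← Finset.sum_smul, ← Finset.smul_sum] at hγ' ⊢
  -- By invariance the two halves of the commutators in `Vect.jac_lie` have equal sums, hence they
  -- cancel.
  rw [sub_eq_zero.1 hγ']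
  simp only [jac_apply]
  module

/-- The terms of `two_smul_lie_chiMul` coming from the first factor. -/
noncomputable def jacTerm (γ : Gl m [⋀^Fin t]→L[ℝ] ℝ) (I : Cov m [⋀^Fin u]→L[ℝ] V) (x : Eu m) (i : Fin t)
    (Y : Vect m) (X : Fin (t + u) → Vect m) : V :=
  γ (Function.update (fun i => jac (X (Fin.castAdd u i)) x) i
      (fderiv ℝ (jac (X (Fin.castAdd u i))).1 x (Y x)
        + fderiv ℝ (jac Y).1 x (X (Fin.castAdd u i) x)))
    • I (fun j => dtr (X (Fin.natAdd t j)) x)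

/-- The terms of `two_smul_lie_chiMul` coming from the second factor. -/
noncomputable def dtrTerm (γ : Gl m [⋀^Fin t]→L[ℝ] ℝ) (I : Cov m [⋀^Fin u]→L[ℝ] V) (x : Eu m) (j : Fin u)
    (Y : Vect m) (X : Fin (t + u) → Vect m) : V :=
  γ (fun i => jac (X (Fin.castAdd u i)) x)
    • I (Function.update (fun j => dtr (X (Fin.natAdd t j)) x) j
      (⁅Y, dtr (X (Fin.natAdd t j))⁆ x + ⁅X (Fin.natAdd t j), dtr Y⁆ x))

/-- This is the symmetry that alternation kills: exchanging Y with the field in slot i only permutes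
the two summands placed in that slot. `dtrTerm_update` plays the same role for the covector slots.
-/
theorem jacTerm_update (γ : Gl m [⋀^Fin t]→L[ℝ] ℝ) (I : Cov m [⋀^Fin u]→L[ℝ] V) (x : Eu m)
    (i : Fin t) (Y : Vect m) (X : Fin (t + u) → Vect m) :
    jacTerm γ I x i (X (Fin.castAdd u i)) (Function.update X (Fin.castAdd u i) Y)
      = jacTerm γ I x i Y X := by
  rw [jacTerm, jacTerm, (update_jac X i Y x).1, (update_jac X i Y x).2]
  simp only [Function.update_self, Function.update_idem]
  rw [add_comm]

theorem dtrTerm_update (γ : Gl m [⋀^Fin t]→L[ℝ] ℝ) (I : Cov m [⋀^Fin u]→L[ℝ] V) (x : Eu m)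
    (j : Fin u) (Y : Vect m) (X : Fin (t + u) → Vect m) :
    dtrTerm γ I x j (X (Fin.natAdd t j)) (Function.update X (Fin.natAdd t j) Y)
      = dtrTerm γ I x j Y X := by
  rw [dtrTerm, dtrTerm, (update_dtr X j Y x).1, (update_dtr X j Y x).2]
  simp only [Function.update_self, Function.update_idem]
  rw [add_comm]

/-- An invariant form and an equivariant map give a cocycle. -/
theorem chi_smulRight_mem_cocycles {γ : Gl m [⋀^Fin t]→L[ℝ] ℝ} (hγ : γ ∈ glInv m t)
    {I : Cov m [⋀^Fin u]→L[ℝ] V} (hI : IsGlEquivariant I) :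
    χ (γ.smulRight I) ∈ CE.cocycles ℝ (slProj m) (Sec m V) (t + u) := by
  rw [chi_eq_smul_alternatization]
  refine Submodule.smul_mem _ _ (LinearMap.mem_ker.2 (AlternatingMap.ext fun X => Sec.ext fun x => ?_))
  refine CE.map_d_alternatization_eq_zero (Sec.eval x) _
    -- Slot k is an argument of γ or of I, and the symmetric term is chosen accordingly; argument 0
    -- is the field that differentiates.
    (fun k y => Fin.addCases
      (fun i => jacTerm γ I x i (y 0).1 fun k => (y k.succ).1)
      (fun j => dtrTerm γ I x j (y 0).1 fun k => (y k.succ).1) k) ?_ ?_ X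
  · intro y
    have h := two_smul_lie_chiMul hγ hI (y 0).1 (fun k => (y k.succ).1) x
    have hs : ∀ (f : Fin t → V) (g : Fin u → V),
        ∑ k, Fin.addCases (motive := fun _ => V) f g k = ∑ i, f i + ∑ j, g j := fun f g => by
      simp [Fin.sum_univ_add]
    rw [Finset.sum_smul, Finset.smul_sum] at h
    refine Eq.trans ?_ (h.trans (hs _ _).symm)
    rw [map_sub, map_sum]
    congr 1
    refine Finset.sum_congr rfl fun k _ => ?_
    rw [MultilinearMap.compLinearMap_apply, Sec.eval_apply]
    refine congrArg (fun Z => chiMul (γ.smulRight I) Z x) (funext fun l => ?_)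
    rcases eq_or_ne l k with rfl | hl
    · simp only [Function.update_self]; rfl
    · simp only [Function.update_of_ne hl]; rfl
  · intro k y
    -- On the arguments after the first, the transposition amounts to writing y₀ into slot k.
    have hX : (fun l : Fin (t + u) => (y (Equiv.swap 0 k.succ l.succ)).1)
        = Function.update (fun l => (y l.succ).1) k (y 0).1 := by
      funext l
      rcases eq_or_ne l k with rfl | hl
      · simp
      · rw [Function.update_of_ne hl, Equiv.swap_apply_of_ne_of_ne (Fin.succ_ne_zero l)
          fun h => hl (Fin.succ_injective _ h)]
    rw [hX]
    dsimp only
    rw [Equiv.swap_apply_left]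
    induction k using Fin.addCases with
    | left i =>
      simp only [Fin.addCases_left]
      exact jacTerm_update γ I x i (y 0).1 fun l => (y l.succ).1
    | right j =>
      simp only [Fin.addCases_right]
      exact dtrTerm_update γ I x j (y 0).1 fun l => (y l.succ).1

end ChiCocycle

/-! ### Equivariance and trace identities for contractions. -/

section Contractions

variable {m : ℕ}

theorem lam_act_apply {p : ℕ} (A : Gl m) (T : Lam m p) (β : Fin p → Cov m) :
    GlRep.act A T β = ∑ i, T (Function.update β i ((β i).comp A)) :=
  lamAct_apply A T β

theorem cov_act (A : Gl m) (η : Cov m) : GlRep.act A η = -(η.comp A) := rfl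

/-- The action on T is a derivation in its arguments. Its term in the first argument is T(α ∘ A, …),
that is, minus the contraction with ρ(A)α. -/
theorem act_contr {p : ℕ} (A : Gl m) (α : Cov m) (T : Lam m (p + 1)) :
    GlRep.act A (contr p α T) = contr p α (GlRep.act A T) + contr p (GlRep.act A α) T := by
  ext β
  have h0 : Function.update (Matrix.vecCons α β) 0 (α.comp A) = Matrix.vecCons (α.comp A) β :=
    Fin.update_cons_zero _ _ _
  have h1 : ∀ j, Function.update (Matrix.vecCons α β) (Fin.succ j) ((β j).comp A)
      = Matrix.vecCons α (Function.update β j ((β j).comp A)) := fun j =>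
    (Fin.cons_update _ _ _ _).symm
  rw [ContinuousAlternatingMap.add_apply, lam_act_apply, contr_apply, lam_act_apply,
    Fin.sum_univ_succ, cov_act, map_neg]
  simp only [_root_.neg_apply, ContinuousAlternatingMap.neg_apply, contr_apply,
    Matrix.cons_val_zero, Matrix.cons_val_succ, h0, h1]
  abel

/-- Induction on the number of contractions, peeling off the innermost one (the last covector) with
`act_contr`. -/
theorem isGlEquivariant_I₀ (q n : ℕ) : IsGlEquivariant (m := m) (I₀ q n) := by
  intro A α
  induction n with
  | zero =>
    ext1 T
    rw [glRepHom_apply, I₀_apply, Finset.univ_eq_empty, Finset.sum_empty]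
    exact sub_self _
  | succ n ih =>
    refine ContinuousLinearMap.ext fun T => ?_
    have h := congrArg (fun f : Lam m (q + n) →L[ℝ] Lam m q => f (contr (q + n) (α (Fin.last n)) T))
      (ih (Fin.init α))
    simp only [glRepHom_apply, I₀_apply, _root_.sum_apply] at h
    simp only [glRepHom_apply, I₀_apply, _root_.sum_apply, contrIter_succ,
      ContinuousLinearMap.comp_apply, Fin.sum_univ_castSucc, Fin.init_update_last,
      Fin.init_update_castSucc, Function.update_self]
    have hl : ∀ (i : Fin n) (z : Cov m),
        Function.update α i.castSucc z (Fin.last n) = α (Fin.last n) := fun i z =>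
      Function.update_of_ne (Fin.castSucc_lt_last i).ne' _ _
    simp only [hl]
    have h2 := congrArg (contrIter q n (Fin.init α))
      (act_contr (p := q + n) A (α (Fin.last n)) T)
    have h3 : ∀ (F : Fin n → Lam m (q + n + 1) →L[ℝ] Lam m q)
        (G : Lam m (q + n + 1) →L[ℝ] Lam m q) (T : Lam m (q + n + 1)),
        (∑ i, F i + G) T = ∑ i, F i T + G T := fun F G T => by
      rw [_root_.add_apply, _root_.sum_apply]
    rw [map_add] at h2
    refine Eq.trans ?_ (h3 _ _ T).symm
    refine Eq.trans ?_ (congrArg (· + _) h)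
    refine Eq.trans ?_ (congrArg (fun z => _ - z + _) h2.symm)
    have h4 : ∀ a b c : Lam m q, a - b = a - (b + c) + c := fun a b c => by abel
    exact h4 _ _ _

/-- This is the equivariance of I₀ with η as first covector: the term where A acts on η is the one
that the action on maps from ℝ^{m*} subtracts. -/
theorem isGlEquivariant_I₁ (q r : ℕ) :
    IsGlEquivariant (V := Cov m →L[ℝ] Lam m (q + (r + 1)) →L[ℝ] Lam m q) (I₁ q r) := by
  intro A α
  ext1 η
  have h := isGlEquivariant_I₀ q (r + 1) A (Matrix.vecCons η α)
  have h0 : Function.update (Matrix.vecCons η α) 0 (GlRep.act A η)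
      = Matrix.vecCons (GlRep.act A η) α := Fin.update_cons_zero _ _ _
  have h1 : ∀ j, Function.update (Matrix.vecCons η α) (Fin.succ j) (GlRep.act A (α j))
      = Matrix.vecCons η (Function.update α j (GlRep.act A (α j))) := fun j =>
    (Fin.cons_update _ _ _ _).symm
  rw [Fin.sum_univ_succ] at h
  simp only [Matrix.cons_val_zero, Matrix.cons_val_succ, h0, h1] at h
  rw [glRepHom_apply, _root_.sum_apply]
  exact sub_eq_iff_eq_add'.2 h

/-- The outermost contraction i_η anticommutes past the n others. Once innermost, it meets ρ
directly, as `sum_contr_act` requires. -/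
theorem contrIter_vecCons (q n : ℕ) (η : Cov m) (α : Fin n → Cov m) (T : Lam m (q + n + 1)) :
    contrIter q (n + 1) (Matrix.vecCons η α) T
      = (-1 : ℝ) ^ n • contrIter q n α (contr (q + n) η T) := by
  induction n with
  | zero =>
    rw [contrIter_succ, pow_zero, one_smul]
    rfl
  | succ n ih =>
    have hi : Fin.init (Matrix.vecCons η α : Fin (n + 2) → Cov m)
        = Matrix.vecCons η (Fin.init α) := by
      funext k
      induction k using Fin.cases with
      | zero => rfl
      | succ k => rfl
    have hl : (Matrix.vecCons η α : Fin (n + 2) → Cov m) (Fin.last (n + 1)) = α (Fin.last n) := rfl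
    rw [contrIter_succ, ContinuousLinearMap.comp_apply, hi, hl]
    refine (ih (Fin.init α) (contr (q + n + 1) (α (Fin.last n)) T)).trans ?_
    rw [pow_succ, mul_neg_one, neg_smul, ← smul_neg]
    congr 1
    refine (congrArg _ (contr_contr η (α (Fin.last n)) T)).trans ?_
    exact map_neg _ _

/-- The endomorphism α ⊗ eᵢ + α(eᵢ) id is the second derivative of a projective field in direction
eᵢ. By antisymmetry only its action on the contracted argument counts, so the constant does not
depend on the degree p. -/
theorem sum_contr_act {p : ℕ} (α : Cov m) (T : Lam m (p + 1)) :
    ∑ i, contr p (dx i) (GlRep.act (α.smulRight (ebasis i)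
      + α (ebasis i) • ContinuousLinearMap.id ℝ (Eu m)) T) = ((m : ℝ) + 1) • contr p α T := by
  ext β
  have hc : ∀ (η : Cov m) (i : Fin m), η.comp (α.smulRight (ebasis i)
      + α (ebasis i) • ContinuousLinearMap.id ℝ (Eu m)) = η (ebasis i) • α + α (ebasis i) • η := by
    intro η i
    ext v
    simp [mul_comm]
  have h0 : ∀ (η ζ : Cov m), Function.update (Matrix.vecCons η β) 0 ζ = Matrix.vecCons ζ β :=
    fun _ _ => Fin.update_cons_zero _ _ _
  have hlin : ∀ (i : Fin m) (η : Cov m) (y : Fin (p + 1) → Cov m) (k : Fin (p + 1)),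
      T (Function.update y k (η (ebasis i) • α + α (ebasis i) • η))
        = η (ebasis i) * T (Function.update y k α) + α (ebasis i) * T (Function.update y k η) := by
    intro i η y k
    rw [T.map_update_add, T.map_update_smul, T.map_update_smul]
    rfl
  have hsum : ∀ (η : Cov m) (y : Fin (p + 1) → Cov m),
      ∑ i, η (ebasis i) * T (Function.update y 0 (dx i)) = T (Function.update y 0 η) := by
    intro η y
    have h := map_sum (T.toMultilinearMap.toLinearMap y 0) (fun i => η (ebasis i) • dx i)
      Finset.univ
    rw [← Cov.eq_sum] at h
    refine Eq.trans ?_ h.symm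
    exact Finset.sum_congr rfl fun i _ => (T.map_update_smul y 0 (η (ebasis i)) (dx i)).symm
  have hterm : ∀ j : Fin p, ∑ i, T (Function.update (Matrix.vecCons (dx i) β) j.succ
      (β j (ebasis i) • α + α (ebasis i) • β j)) = 0 := by
    intro j
    have e1 : ∀ (i : Fin m) (ζ : Cov m), Function.update (Matrix.vecCons (dx i) β) j.succ ζ
        = Function.update (Function.update (Matrix.vecCons 0 β) j.succ ζ) 0 (dx i) := by
      intro i ζ
      rw [Function.update_comm (Fin.succ_ne_zero j), h0]
    simp only [hlin, Finset.sum_add_distrib]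
    simp only [e1, hsum]
    have hsw := T.map_swap (Function.update (Function.update (Matrix.vecCons 0 β) j.succ α) 0 (β j))
      (Fin.succ_ne_zero j)
    rw [eq_neg_iff_add_eq_zero, add_comm] at hsw
    refine Eq.trans ?_ hsw
    refine congrArg (T _ + T ·) (funext fun k => ?_)
    rw [Function.comp_apply]
    rcases eq_or_ne k 0 with rfl | hk
    · simp
    rcases eq_or_ne k j.succ with rfl | hj
    · simp
    · simp [Equiv.swap_apply_of_ne_of_ne hj hk, hk, hj]
  -- Here dx^i(eᵢ) = 1 gives m copies of T(α, β), and ∑ α(eᵢ) dx^i = α gives one more.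
  have hfirst : ∑ i, T (Function.update (Matrix.vecCons (dx i) β) 0
      (dx i (ebasis i) • α + α (ebasis i) • dx i)) = ((m : ℝ) + 1) * T (Matrix.vecCons α β) := by
    have h := hsum α (Matrix.vecCons 0 β)
    simp only [h0] at h
    simp only [hlin, Finset.sum_add_distrib]
    simp only [h0, h]
    simp
    ring
  simp only [ContinuousAlternatingMap.sum_apply, contr_apply, lam_act_apply, hc,
    ContinuousAlternatingMap.smul_apply, smul_eq_mul]
  simp only [Fin.sum_univ_succ, Matrix.cons_val_zero, Matrix.cons_val_succ,
    Finset.sum_add_distrib]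
  rw [hfirst, Finset.sum_comm, Finset.sum_eq_zero fun j _ => hterm j, add_zero]

end Contractions

/-! ### Lifting symbols to operators. -/

section SymbolLift

variable {m : ℕ} {V W : Type} [NormedAddCommGroup V] [NormedSpace ℝ V]
  [NormedAddCommGroup W] [NormedSpace ℝ W] [GlRep m V] [GlRep m W]

/-- The differential operator of order one, without zeroth-order term, of a given symbol. -/
noncomputable def liftOp : Symb1 m V W →ₗ[ℝ] DiffOp1 m V W where
  toFun s := ⟨op 0 s, s, 0, rfl⟩
  map_add' s s' := Subtype.ext (by simpa using op_add (0 : Sec m (V →L[ℝ] W)) 0 s s')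
  map_smul' r s := Subtype.ext (by simpa using op_smul r (0 : Sec m (V →L[ℝ] W)) s)

theorem lie_liftOp (g : LieSubalgebra ℝ (Vect m)) (X : g) (s : Symb1 m V W) :
    ⁅X, liftOp s⁆ = liftOp ⁅X, s⁆ + inclD V W g (mulOp (opCorr X.1 s)) := by
  refine Subtype.ext ?_
  change ⁅X.1, op 0 s⁆ = op 0 ⁅X.1, s⁆ + op (opCorr X.1 s) 0
  rw [lie_op, lie_zero, ← op_add, add_zero]

/-- Were the lift equivariant, the coboundary of the lifted cocycle would vanish; what is left is
the defect from `lie_liftOp` in each bracket. -/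
theorem d_liftOp (g : LieSubalgebra ℝ (Vect m)) {n : ℕ} (c : g [⋀^Fin n]→ₗ[ℝ] Symb1 m V W)
    (hc : c ∈ CE.cocycles ℝ g (Symb1 m V W) n) (X : Fin (n + 1) → g) :
    CE.d n (liftOp.compAlternatingMap c) X
      = inclD V W g (mulOp (∑ i : Fin (n + 1), (-1 : ℝ) ^ (i : ℕ) • opCorr (X i).1 (c (i.removeNth X)))) := by
  have h := congrArg (fun b => liftOp (b X)) (LinearMap.mem_ker.1 hc)
  simp only [CE.d_apply, AlternatingMap.zero_apply, map_zero, map_sum, map_smul, map_sub] at h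
  simp only [CE.d_apply, LinearMap.compAlternatingMap_apply, lie_liftOp, map_sum, map_smul]
  symm
  -- The zero being added is the lift of the cocycle condition, so the two sides can be matched term
  -- by term in i.
  rw [← add_zero (∑ i, _), ← h, ← Finset.sum_add_distrib]
  refine Finset.sum_congr rfl fun i _ => ?_
  module

/-- `opCorr` at a point, as a function of the symbol. -/
noncomputable def opCorrAt (X : Vect m) (x : Eu m) : (Cov m →L[ℝ] V →L[ℝ] W) →ₗ[ℝ] (V →L[ℝ] W) where
  toFun h := ∑ i, (h (dx i)).comp (GlRep.act (fderiv ℝ (fderiv ℝ X.1) x (ebasis i)))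
  map_add' h h' := by
    rw [← Finset.sum_add_distrib]
    exact Finset.sum_congr rfl fun i _ => by rw [_root_.add_apply, ContinuousLinearMap.add_comp]
  map_smul' r h := by
    rw [Finset.smul_sum]
    exact Finset.sum_congr rfl fun i _ => by
      rw [_root_.smul_apply, ContinuousLinearMap.smul_comp, RingHom.id_apply]

theorem opCorr_apply (X : Vect m) (s : Symb1 m V W) (x : Eu m) :
    opCorr X s x = opCorrAt X x (s x) := rfl

end SymbolLift

/-! ### Second derivatives of projective vector fields. -/

section Computation

variable {m : ℕ}

/-- Only the quadratic part α(x)x contributes. Its second derivative is independent of x, and taking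
traces with tr(α ⊗ e) = α(e) and tr id = m gives the factor m + 1. -/
theorem fderiv_fderiv_slProj (X : slProj m) : ∃ α : Cov m,
    (∀ x e, fderiv ℝ (fderiv ℝ X.1.1) x e = α.smulRight e + α e • ContinuousLinearMap.id ℝ (Eu m))
      ∧ ∀ x, dtr X.1 x = ((m : ℝ) + 1) • α := by
  obtain ⟨_, h, A, α, rfl⟩ := X
  have hd : ∀ x e, fderiv ℝ (fderiv ℝ (hField h + AField A + αField α).1) x e
      = α.smulRight e + α e • ContinuousLinearMap.id ℝ (Eu m) := by
    intro x e
    ext1 v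
    have h1 := ((hField h + AField A + αField α).diff_fderiv x).hasFDerivAt.clm_apply
      (hasFDerivAt_const v x)
    have h2 : HasFDerivAt (fun y : Eu m => -(A v) + (α v • y + α y • v))
        (α v • ContinuousLinearMap.id ℝ (Eu m) + α.smulRight v) x :=
      (((hasFDerivAt_id x).const_smul (α v)).add (α.hasFDerivAt.smul_const v)).const_add _
    have h3 := h1.unique (h2.congr_of_eventuallyEq (Filter.Eventually.of_forall fun y =>
      fderiv_projField h A α y v))
    have h4 := congrArg (fun f : Gl m => f e) h3
    simpa using h4
  refine ⟨α, hd, fun x => ?_⟩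
  ext1 e
  rw [dtr_apply_eq_traceGl, hd, map_add, map_smul]
  have h1 : traceGl m (α.smulRight e) = α e := LinearMap.trace_smulRight (α : Eu m →ₗ[ℝ] ℝ) e
  have h2 : traceGl m (ContinuousLinearMap.id ℝ (Eu m)) = m := by
    rw [traceGl_apply, ContinuousLinearMap.coe_id, LinearMap.trace_id]
    simp
  rw [h1, h2]
  simp
  ring

/-- The factor m + 1 of `sum_contr_act` is the one in d tr DX = (m+1)α, so no constant appears here.
The signs (-1)^r from moving i_{dx^i} inwards and i_{d tr DX} back outwards cancel. -/
theorem opCorrAt_I₁ (q r : ℕ) (X : slProj m) (x : Eu m) (β : Fin r → Cov m) :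
    opCorrAt X.1 x (I₁ q r β) = I₀ q (r + 1) (Matrix.vecCons (dtr X.1 x) β) := by
  obtain ⟨α, h, hα⟩ := fderiv_fderiv_slProj X
  refine ContinuousLinearMap.ext fun T => ?_
  have h1 : opCorrAt X.1 x (I₁ q r β) T
      = ∑ i, contrIter q (r + 1) (Matrix.vecCons (dx i) β)
        (GlRep.act (α.smulRight (ebasis i) + α (ebasis i) • ContinuousLinearMap.id ℝ (Eu m)) T) := by
    simp only [opCorrAt, LinearMap.coe_mk, AddHom.coe_mk, h]
    exact _root_.sum_apply _ _ _
  have h2 := congrArg ((-1 : ℝ) ^ r • contrIter q r β ·) (sum_contr_act (p := q + r) α T)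
  rw [h1, hα, I₀_apply]
  refine (Finset.sum_congr rfl fun i _ => contrIter_vecCons q r (dx i) β _).trans ?_
  refine Eq.trans ?_ (contrIter_vecCons q r _ β T).symm
  have h3 : contr (q + r) (((m : ℝ) + 1) • α) T = ((m : ℝ) + 1) • contr (q + r) α T := by
    rw [ContinuousLinearMap.map_smul]
    rfl
  refine Eq.trans ?_ (h2.trans (congrArg ((-1 : ℝ) ^ r • contrIter q r β ·) h3.symm))
  rw [map_sum, Finset.smul_sum]

theorem opCorrAt_smul_I₁ (q r : ℕ) (X : slProj m) (x : Eu m) (c : ℝ) (β : Fin r → Cov m) :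
    opCorrAt X.1 x (c • I₁ q r β) = c • I₀ q (r + 1) (Matrix.vecCons (dtr X.1 x) β) := by
  rw [← opCorrAt_I₁]
  exact (opCorrAt X.1 x).map_smul c (I₁ q r β)

/-- Substitution of νπ for ν in the sum. -/
theorem sum_sign_perm_comp {L M : Type*} [AddCommGroup M] {n : ℕ} (π : Equiv.Perm (Fin n))
    (f : (Fin n → L) → M) (x : Fin n → L) :
    ∑ ν : Equiv.Perm (Fin n), (Equiv.Perm.sign ν : ℤ) • f (fun k => x (ν (π k)))
      = (Equiv.Perm.sign π : ℤ) • ∑ ν : Equiv.Perm (Fin n),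
        (Equiv.Perm.sign ν : ℤ) • f (fun k => x (ν k)) := by
  rw [← Equiv.sum_comp (Equiv.mulRight π) (fun ν => (Equiv.Perm.sign ν : ℤ) • f (fun k => x (ν k))),
    Finset.smul_sum]
  refine Finset.sum_congr rfl fun ν _ => ?_
  simp only [Equiv.coe_mulRight, Equiv.Perm.sign_mul, Equiv.Perm.mul_apply, smul_smul,
    Units.val_mul]
  rcases Int.units_eq_one_or (Equiv.Perm.sign π) with h | h <;> simp [h]


end Computation

/-! ### The connecting homomorphism on cocycles. -/

section Connecting

variable {m : ℕ} {V W : Type} [NormedAddCommGroup V] [NormedSpace ℝ V]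
  [NormedAddCommGroup W] [NormedSpace ℝ W] [GlRep m V] [GlRep m W]

/-- The connecting homomorphism is computed by the cochain
`∑ i, (-1)^i opCorr Xᵢ (c (X₀, …, X̂ᵢ, …, X_n))`. -/
theorem θ_cls (g : LieSubalgebra ℝ (Vect m)) {n : ℕ} {c : g [⋀^Fin n]→ₗ[ℝ] Symb1 m V W}
    (hc : c ∈ CE.cocycles ℝ g (Symb1 m V W) n) (e : g [⋀^Fin (n + 1)]→ₗ[ℝ] Sec m (V →L[ℝ] W))
    {k : ℝ} (hk : k ≠ 0)
    (he : ∀ X : Fin (n + 1) → g,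
      ∑ i : Fin (n + 1), (-1 : ℝ) ^ (i : ℕ) • opCorr (X i).1 (c (i.removeNth X)) = k • e X) :
    ∃ h₀ : mulOp.compAlternatingMap e ∈ CE.cocycles ℝ g (DiffOp0 m V W) (n + 1),
      θ V W g n (CE.cls c hc) = k • CE.cls _ h₀ := by
  have hb : (inclD V W g : _ →ₗ[ℝ] _).compAlternatingMap (k • mulOp.compAlternatingMap e)
      = CE.d n (liftOp.compAlternatingMap c) := by
    ext1 X
    refine Eq.trans ?_ (d_liftOp g c hc X).symm
    rw [he, map_smul mulOp]
    rfl
  -- The image in 𝒟¹ is a coboundary, hence closed, and the inclusion is injective. As k ≠ 0, `e`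
  -- itself then gives a cocycle, without any equivariance assumption on it.
  have hke : k • mulOp.compAlternatingMap e ∈ CE.cocycles ℝ g (DiffOp0 m V W) (n + 1) := by
    refine LinearMap.mem_ker.2 (CE.comp_inj (inclD_injective V W g) ?_)
    rw [← CE.d_comp, hb, CE.d_d]
    ext1 X
    exact (map_zero (inclD V W g : DiffOp0 m V W →ₗ[ℝ] DiffOp1 m V W)).symm
  have hs : (symbolD V W g : _ →ₗ[ℝ] _).compAlternatingMap (liftOp.compAlternatingMap c) = c :=
    AlternatingMap.ext fun X => symbolD_eq g rfl
  exact ⟨(Submodule.smul_mem_iff _ hk).1 hke, CE.connecting_cls _ _ _ c hc _ hs _ hb hke⟩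

end Connecting

/-! ### Comparison of constants and conclusion. -/

set_option maxHeartbeats 1000000 in
theorem sum_opCorr_chi (m q r a : ℕ) (γ : Gl m [⋀^Fin a]→L[ℝ] ℝ) (X : Fin (a + r + 1) → slProj m) :
    ∑ i : Fin (a + r + 1), (-1 : ℝ) ^ (i : ℕ) •
        opCorr (X i).1 (χ (γ.smulRight (I₁ q r)) (i.removeNth X))
      = ((-1 : ℝ) ^ a * ((r : ℝ) + 1) * ((m : ℝ) + 1)) • χ (γ.smulRight (I₀ q (r + 1))) X := by
  -- `f` is the correction term, whose argument 0 supplies the new covector ahead of the arguments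
  -- of γ; `g` has the order used by χ, with the arguments of γ first.
  let f : (Fin (a + r + 1) → slProj m) → Eu m → (Lam m (q + (r + 1)) →L[ℝ] Lam m q) := fun y x =>
    γ (fun i => jac (y (Fin.castAdd r i).succ).1 x)
      • I₀ q (r + 1) (Matrix.vecCons (dtr (y 0).1 x) fun j => dtr (y (Fin.natAdd a j).succ).1 x)
  let g : (Fin (a + r + 1) → slProj m) → Eu m → (Lam m (q + (r + 1)) →L[ℝ] Lam m q) := fun y x =>
    γ (fun i => jac (y (Fin.castAdd (r + 1) i)).1 x)
      • I₀ q (r + 1) (fun j => dtr (y (Fin.natAdd a j)).1 x)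
  -- The cycle on the first a + 1 indices takes one order to the other; its sign is the factor
  -- (-1)^a.
  let k : Fin (a + r + 1) := ⟨a, by omega⟩
  have hfg : ∀ y x, f y x = g (fun l => y (k.cycleRange l)) x := by
    intro y x
    have h1 : ∀ i : Fin a, k.cycleRange (Fin.castAdd (r + 1) i) = (Fin.castAdd r i).succ := by
      intro i
      refine Fin.ext ?_
      rw [Fin.coe_cycleRange_of_lt (Fin.lt_def.2 i.2)]
      rfl
    have h2 : k.cycleRange (Fin.natAdd a (0 : Fin (r + 1))) = 0 := Fin.cycleRange_self k
    have h3 : ∀ j : Fin r, k.cycleRange (Fin.natAdd a j.succ) = (Fin.natAdd a j).succ := by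
      intro j
      rw [Fin.cycleRange_of_gt (Fin.lt_def.2 (by simp [k]))]
      rfl
    simp only [f, g, h1]
    congr 2
    funext j
    induction j using Fin.cases with
    | zero => simp only [h2, Matrix.cons_val_zero]
    | succ j => simp only [h3, Matrix.cons_val_succ]
  ext1 x
  rw [← Sec.eval_apply, map_sum]
  have hχ : ∀ i : Fin (a + r + 1), Sec.eval x ((-1 : ℝ) ^ (i : ℕ) •
      opCorr (X i).1 (χ (γ.smulRight (I₁ q r)) (i.removeNth X)))
      = ((-1 : ℝ) ^ a / (a.factorial * r.factorial * ((m : ℝ) + 1) ^ r)) •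
        (-1 : ℤ) ^ (i : ℕ) • ∑ σ : Equiv.Perm (Fin (a + r)), (Equiv.Perm.sign σ : ℤ) •
          f (Fin.cons (X i) fun k => i.removeNth X (σ k)) x := by
    intro i
    rw [map_smul, Sec.eval_apply, opCorr_apply, χ_apply, map_smul, map_sum,
      CE.neg_one_pow_smul_int, smul_comm]
    congr 2
    refine Finset.sum_congr rfl fun σ _ => ?_
    refine (map_zsmul (opCorrAt (X i).1 x) _ _).trans (congrArg _ ?_)
    exact opCorrAt_smul_I₁ q r (X i) x _ _
  rw [Finset.sum_congr rfl fun i _ => hχ i, ← Finset.smul_sum]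
  -- The sum over the omitted index i and the permutations of the rest is a single signed sum over
  -- all permutations.
  have h4 := (sum_sign_perm_succ (f · x) X).symm
  rw [h4]
  simp only [hfg]
  rw [sum_sign_perm_comp k.cycleRange (g · x) X, Fin.sign_cycleRange, Sec.smul_apply]
  have h5 : χ (γ.smulRight (I₀ q (r + 1))) X x
      = ((-1 : ℝ) ^ a / (a.factorial * (r + 1).factorial * ((m : ℝ) + 1) ^ (r + 1))) •
        ∑ ν : Equiv.Perm (Fin (a + r + 1)), (Equiv.Perm.sign ν : ℤ) • g (fun k => X (ν k)) x :=
    χ_apply _ _ _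
  rw [h5, ← Int.cast_smul_eq_zsmul ℝ, smul_smul, smul_smul]
  congr 1
  have hm : (m : ℝ) + 1 ≠ 0 := by positivity
  have hr : (r : ℝ) + 1 ≠ 0 := by positivity
  rw [Nat.factorial_succ]
  simp only [k]
  push_cast
  field_simp
  ring


set_option maxHeartbeats 1000000 in
theorem chi_I₁_mem_cocycles (m q r : ℕ) {a : ℕ} {γ : Gl m [⋀^Fin a]→L[ℝ] ℝ} (hγ : γ ∈ glInv m a) :
    χ (γ.smulRight (I₁ q r)) ∈
      CE.cocycles ℝ (slProj m) (Symb1 m (Lam m (q + (r + 1))) (Lam m q)) (a + r) :=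
  chi_smulRight_mem_cocycles hγ (isGlEquivariant_I₁ (m := m) q r)

set_option maxHeartbeats 1000000 in
theorem lemma3p2 (m q r a : ℕ) (γ : Gl m [⋀^Fin a]→L[ℝ] ℝ) (hγ : γ ∈ glInv m a) :
    ∃ (h₁ : χ (γ.smulRight (I₁ q r)) ∈
          CE.cocycles ℝ (slProj m) (Symb1 m (Lam m (q + (r + 1))) (Lam m q)) (a + r))
      (h₀ : mulOp.compAlternatingMap (χ (γ.smulRight (I₀ q (r + 1)))) ∈
          CE.cocycles ℝ (slProj m) (DiffOp0 m (Lam m (q + (r + 1))) (Lam m q)) (a + r + 1)),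
      θ (Lam m (q + (r + 1))) (Lam m q) (slProj m) (a + r) (CE.cls _ h₁)
        = ((-1 : ℝ) ^ a * (((q + (r + 1) : ℕ) : ℝ) - (q : ℝ)) * ((m : ℝ) + 1)) • CE.cls _ h₀ := by
  -- The condition p > q is encoded as p = q + (r + 1), so p - q = r + 1; in particular the constant
  -- is nonzero.
  have hk : (-1 : ℝ) ^ a * ((r : ℝ) + 1) * ((m : ℝ) + 1)
      = (-1 : ℝ) ^ a * (((q + (r + 1) : ℕ) : ℝ) - (q : ℝ)) * ((m : ℝ) + 1) := by
    push_cast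
    ring
  have hk0 : (-1 : ℝ) ^ a * (((q + (r + 1) : ℕ) : ℝ) - (q : ℝ)) * ((m : ℝ) + 1) ≠ 0 := by
    rw [← hk]
    exact mul_ne_zero (mul_ne_zero (pow_ne_zero _ (by norm_num)) (by positivity)) (by positivity)
  exact Exists.intro (chi_I₁_mem_cocycles m q r hγ) (θ_cls (slProj m) (chi_I₁_mem_cocycles m q r hγ)
    (χ (t := a) (u := r + 1) (γ.smulRight (I₀ q (r + 1)))) hk0
    (by rw [← hk]; exact sum_opCorr_chi m q r a γ))
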